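/- **Conventions.** Composition is written in diagrammatic order, $f;g$. A *cartesian left-additive category* is a symmetric monoidal category whose unit $I$ is terminal and whose tensor $\times$ is the categorical product (with projections $\pi_i$, copy $\Delta_A=\langle \mathrm{id},\mathrm{id}\rangle: A\to A\times A$, discard $!_A: A\to I$, symmetry $\sigma$), in which each object $A$ carries a commutative monoid $+_A: A\times A\to A$, $0_A: I\to A$, such that $+_{A\times B}$ and $0_{A\times B}$ are the componentwise operations. It is *cartesian distributive* if each object also carries a commutative monoid $\cdot_A: A\times A\to A$, $1_A: I\to A$ with $(x+y)\cdot z = x\cdot z+y\cdot z$ and $x\cdot 0=0$. Below, morphisms are written on generalized elements. A *reverse derivative category* (RDC) is a cartesian left-additive category with an operator $R$ sending $f: A\to B$ to $R[f]: A\times B\to A$ such that, with $$D[f](x,v)=\pi_B\big(R[R[f]]((x,0),v)\big)\quad (f:A\to B),\qquad D_B[g](a,b,w)=D[g]((a,b),(0,w))\quad (g:A\times B\to C),$$ the following hold for all objects and morphisms: 1. $R[\mathrm{id}](x,d)=d$, $R[\Delta](x,d_1,d_2)=d_1+d_2$, $R[+](x,y,d)=(d,d)$, $R[\sigma](x,y,d_1,d_2)=(d_2,d_1)$,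 $R[!]=0$, $R[0]=\,!$, $R[f;g](a,c)=R[f](a,R[g](f(a),c))$, and $R[f\times g]((a,a'),(b,b'))=(R[f](a,b),R[g](a',b'))$; 2. $R[f](a,b+c)=R[f](a,b)+R[f](a,c)$ and $R[f](a,0)=0$; 3. $D_B[R[f]](a,b,w)=R[f](a,w)$ for $f:A\to B$; 4. $D[D[f]]((x,v),(w,z))=D[D[f]]((x,w),(v,z))$. **Polynomial circuits.** Let $S$ be a commutative semiring. $\mathsf{PolyCirc}_S$ is the (strict) cartesian distributive category presented by one generating object $1$ (so objects are natural numbers, with tensor given by addition, and the structure on every object is the componentwise one induced by that on $1$), a generating morphism $\underline s: 0\to 1$ for each $s\in S$, and the equations $$\underline 0=0_1,\qquad \underline 1=1_1,\qquad (\underline s\times\underline t);+_1=\underline{s+t},\qquad (\underline s\times\underline t);\cdot_1=\underline{s\cdot t}\qquad (s,t\in S).$$ $\mathsf{PolyCirc}^{=}_S$ is the cartesian distributive category presented by the same data together with one more generating morphism $\mathrm{compare}: 1\times 1\to 1$ and the equations $$(\underline s\times\underline s);\mathrm{compare}=1_1,\qquad (\underline s\times\underline t);\mathrm{compare}=0_1\quad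 (s,t\in S,\ s\ne t).$$ Let $\iota:\mathsf{PolyCirc}_S\to\mathsf{PolyCirc}^{=}_S$ be the evident identity-on-objects functor. **Theorem.** For every commutative semiring $S$: * there is an operator $R_0$ making $\mathsf{PolyCirc}_S$ an RDC with $R_0[\underline s]=\,!$ for all $s\in S$, and, for every object $A$, $R_0[\cdot_A](x,y,d)=(y\cdot d,\,x\cdot d)$ and $R_0[1_A]=\,!$; * there is an operator $R$ making $\mathsf{PolyCirc}^{=}_S$ an RDC which is as for $\mathsf{PolyCirc}_S$, that is, $R[\iota(f)]=\iota(R_0[f])$ for every morphism $f$ of $\mathsf{PolyCirc}_S$, and which satisfies $$R[\mathrm{compare}]=R[+_1],\qquad\text{i.e. } R[\mathrm{compare}](x,y,d)=(d,d).$$ -/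

import Mathlib

open CategoryTheory MonoidalCategory CartesianMonoidalCategory

universe v u

/-! ### Cartesian left-additive categories and reverse derivative categories

The base notion is Mathlib's `CartesianMonoidalCategory` (a symmetric monoidal category whose unit
is terminal and whose tensor is the categorical product): copying is `lift (𝟙 A) (𝟙 A)`,
discarding is `toUnit A`, and `β_` is the symmetry. -/

/-- A cartesian left-additive category: every object carries a commutative monoid, coherently with
the product. -/
class CartesianLeftAdditive (C : Type u) [Category.{v} C] [CartesianMonoidalCategory C]
    [SymmetricCategory C] where
  add (A : C) : A ⊗ A ⟶ A
  zero (A : C) : 𝟙_ C ⟶ A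
  add_comm (A : C) : (β_ A A).hom ≫ add A = add A
  add_assoc (A : C) : (add A ▷ A) ≫ add A = (α_ A A A).hom ≫ (A ◁ add A) ≫ add A
  add_zero (A : C) : (A ◁ zero A) ≫ add A = (ρ_ A).hom
  add_tensor (A B : C) : add (A ⊗ B) = tensorμ A B A B ≫ (add A ⊗ₘ add B)
  zero_tensor (A B : C) : zero (A ⊗ B) = (λ_ (𝟙_ C)).inv ≫ (zero A ⊗ₘ zero B)

/-- A cartesian distributive category: every object also carries a commutative multiplicative
monoid which distributes over the addition. -/
class CartesianDistributive (C : Type u) [Category.{v} C] [CartesianMonoidalCategory C]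
    [SymmetricCategory C] extends CartesianLeftAdditive C where
  mul (A : C) : A ⊗ A ⟶ A
  one (A : C) : 𝟙_ C ⟶ A
  mul_comm (A : C) : (β_ A A).hom ≫ mul A = mul A
  mul_assoc (A : C) : (mul A ▷ A) ≫ mul A = (α_ A A A).hom ≫ (A ◁ mul A) ≫ mul A
  mul_one (A : C) : (A ◁ one A) ≫ mul A = (ρ_ A).hom
  distrib (A : C) : (add A ▷ A) ≫ mul A =
    ((A ⊗ A) ◁ lift (𝟙 A) (𝟙 A)) ≫ tensorμ A A A A ≫ (mul A ⊗ₘ mul A) ≫ add A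
  mul_zero (A : C) : (A ◁ zero A) ≫ mul A = toUnit (A ⊗ 𝟙_ C) ≫ zero A

namespace ReverseDerivative

variable {C : Type u} [Category.{v} C] [CartesianMonoidalCategory C] [SymmetricCategory C]
  [CartesianLeftAdditive C]

open CartesianLeftAdditive

/-- The zero morphism `A ⟶ B`. -/
def zeroHom (A B : C) : A ⟶ B := toUnit A ≫ zero B

/-- An operator sending `f : A ⟶ B` to `R f : A ⊗ B ⟶ A`. -/
abbrev Operator (C : Type u) [Category.{v} C] [CartesianMonoidalCategory C] :=
  ∀ ⦃A B : C⦄, (A ⟶ B) → (A ⊗ B ⟶ A)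

/-- The forward derivative `D[f] : A ⊗ A ⟶ B`, `(x, v) ↦ π_B (R[R[f]] ((x, 0), v))`. -/
def fwd (R : Operator C) {A B : C} (f : A ⟶ B) : A ⊗ A ⟶ B :=
  lift (lift (fst A A) (zeroHom (A ⊗ A) B)) (snd A A) ≫ R (R f) ≫ snd A B

/-- The partial derivative `D_B[g] : A ⊗ (B ⊗ B) ⟶ X` of `g : A ⊗ B ⟶ X` with respect to `B`,
`(a, (b, w)) ↦ D[g] ((a, b), (0, w))`. -/
def fwdSnd (R : Operator C) {A B X : C} (g : A ⊗ B ⟶ X) : A ⊗ (B ⊗ B) ⟶ X :=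
  lift (lift (fst _ _) (snd _ _ ≫ fst _ _)) (lift (zeroHom _ A) (snd _ _ ≫ snd _ _)) ≫ fwd R g

/-- `(a, (b, w)) ↦ g (a, w)`. The morphism `g` is linear in `B` when this equals `fwdSnd R g`. -/
def dropMid {A B X : C} (g : A ⊗ B ⟶ X) : A ⊗ (B ⊗ B) ⟶ X :=
  (A ◁ snd B B) ≫ g

end ReverseDerivative

/-- `((x, y), d) ↦ (y * d, x * d)`, the reverse derivative of multiplication. -/
def mulRev {C : Type u} [Category.{v} C] [CartesianMonoidalCategory C] [SymmetricCategory C]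
    [CartesianDistributive C] (A : C) : (A ⊗ A) ⊗ A ⟶ A ⊗ A :=
  lift ((snd A A ▷ A) ≫ CartesianDistributive.mul A) ((fst A A ▷ A) ≫ CartesianDistributive.mul A)

open CartesianLeftAdditive ReverseDerivative in
/-- A reverse differential combinator: the structure making a cartesian left-additive category a
reverse derivative category. -/
structure ReverseDifferentialCombinator (C : Type u) [Category.{v} C]
    [CartesianMonoidalCategory C] [SymmetricCategory C] [CartesianLeftAdditive C] where
  /-- The combinator `R`. -/
  R : ∀ ⦃A B : C⦄, (A ⟶ B) → (A ⊗ B ⟶ A)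
  -- structural axioms
  R_id (A : C) : R (𝟙 A) = snd A A
  R_copy (A : C) : R (lift (𝟙 A) (𝟙 A)) = snd A (A ⊗ A) ≫ add A
  R_add (A : C) : R (add A) = snd (A ⊗ A) A ≫ lift (𝟙 A) (𝟙 A)
  R_twist (A B : C) : R (β_ A B).hom = snd (A ⊗ B) (B ⊗ A) ≫ (β_ B A).hom
  R_discard (A : C) : R (toUnit A) = zeroHom (A ⊗ 𝟙_ C) A
  R_zero (A : C) : R (zero A) = toUnit (𝟙_ C ⊗ A)
  -- `(a, c) ↦ R[f] (a, R[g] (f a, c))`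
  R_comp {A B X : C} (f : A ⟶ B) (g : B ⟶ X) :
    R (f ≫ g) = lift (fst A X) ((f ▷ X) ≫ R g) ≫ R f
  -- `((a, a'), (b, b')) ↦ (R[f] (a, b), R[g] (a', b'))`
  R_tensor {A B A' B' : C} (f : A ⟶ B) (g : A' ⟶ B') :
    R (f ⊗ₘ g) = tensorμ A A' B B' ≫ (R f ⊗ₘ R g)
  -- additivity of change: `R[f] (a, b + c) = R[f] (a, b) + R[f] (a, c)`, `R[f] (a, 0) = 0`
  R_additive {A B : C} (f : A ⟶ B) :
    (A ◁ add B) ≫ R f =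
      (lift (𝟙 A) (𝟙 A) ▷ (B ⊗ B)) ≫ tensorμ A A B B ≫ (R f ⊗ₘ R f) ≫ add A
  R_additive_zero {A B : C} (f : A ⟶ B) : (A ◁ zero B) ≫ R f = zeroHom (A ⊗ 𝟙_ C) A
  -- linearity of change
  R_linear {A B : C} (f : A ⟶ B) : fwdSnd R (R f) = dropMid (R f)
  -- symmetry of partial derivatives
  R_symm {A B : C} (f : A ⟶ B) : fwd R (fwd R f) = tensorμ A A A A ≫ fwd R (fwd R f)

/-- Interchanging two units is trivial. -/
theorem tensorμ_unit_unit {C : Type u} [Category.{v} C] [MonoidalCategory C] [BraidedCategory C]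
    (X Y : C) : tensorμ X (𝟙_ C) (𝟙_ C) Y ≫ ((ρ_ X).hom ⊗ₘ (λ_ Y).hom) =
      ((ρ_ X).hom ⊗ₘ (λ_ Y).hom) := by
  have hb : (β_ (𝟙_ C) (𝟙_ C)).hom = 𝟙 _ := by
    rw [braiding_tensorUnit_left, unitors_equal, Iso.hom_inv_id]
  rw [tensorμ, hb]
  monoidal

/-! ### Presented cartesian distributive categories on one generating object

Words over one generating object are natural numbers. The structural generators (copy, discard,
addition, zero, multiplication, one) are present at every word; the coherence equations below
determine them from those at the generating object `1`. -/

/-- Terms over a signature `Γ` of generating morphisms `m → n`. -/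
inductive CircTerm (Γ : ℕ → ℕ → Type u) : ℕ → ℕ → Type u
  | gen {m n : ℕ} (g : Γ m n) : CircTerm Γ m n
  | id (n : ℕ) : CircTerm Γ n n
  | comp {m n k : ℕ} (f : CircTerm Γ m n) (g : CircTerm Γ n k) : CircTerm Γ m k
  | tensor {m n m' n' : ℕ} (f : CircTerm Γ m n) (g : CircTerm Γ m' n') :
      CircTerm Γ (m + m') (n + n')
  | twist (m n : ℕ) : CircTerm Γ (m + n) (n + m)
  | copy (n : ℕ) : CircTerm Γ n (n + n)
  | discard (n : ℕ) : CircTerm Γ n 0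
  | add (n : ℕ) : CircTerm Γ (n + n) n
  | zero (n : ℕ) : CircTerm Γ 0 n
  | mul (n : ℕ) : CircTerm Γ (n + n) n
  | one (n : ℕ) : CircTerm Γ 0 n

namespace CircTerm

variable {Γ : ℕ → ℕ → Type u}

/-- The identity term, between equal words. It mediates the equalities
`(a + b) + c = a + (b + c)` and `0 + n = n` of words, so that monoidal structure is strict. -/
def castId {m n : ℕ} (h : m = n) : CircTerm Γ m n := h ▸ CircTerm.id m

/-- The middle interchange `(a + b) + (c + d) → (a + c) + (b + d)`. -/
def interchange (a b c d : ℕ) : CircTerm Γ ((a + b) + (c + d)) ((a + c) + (b + d)) :=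
  ((castId (by omega)).comp ((CircTerm.id a).tensor ((twist b c).tensor (CircTerm.id d)))).comp
    (castId (by omega))

/-- Renaming of generators. -/
def map {Γ' : ℕ → ℕ → Type u} (φ : ∀ ⦃m n : ℕ⦄, Γ m n → Γ' m n) :
    ∀ {m n : ℕ}, CircTerm Γ m n → CircTerm Γ' m n
  | _, _, gen g => gen (φ g)
  | _, _, id n => id n
  | _, _, comp f g => comp (map φ f) (map φ g)
  | _, _, tensor f g => tensor (map φ f) (map φ g)
  | _, _, twist m n => twist m n
  | _, _, copy n => copy n
  | _, _, discard n => discard n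
  | _, _, add n => add n
  | _, _, zero n => zero n
  | _, _, mul n => mul n
  | _, _, one n => one n

theorem map_castId {Γ' : ℕ → ℕ → Type u} (φ : ∀ ⦃m n : ℕ⦄, Γ m n → Γ' m n) {m n : ℕ}
    (h : m = n) : map φ (castId h) = castId h := by
  subst h; rfl

end CircTerm

/-- A family of equations between parallel terms. -/
abbrev CircEquations (Γ : ℕ → ℕ → Type u) :=
  ∀ ⦃m n : ℕ⦄, CircTerm Γ m n → CircTerm Γ m n → Prop

open CircTerm in
/-- Equality of terms modulo the laws of strict symmetric monoidal categories, the laws of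
cartesian distributive categories, and the equations `E`. -/
inductive CircRel {Γ : ℕ → ℕ → Type u} (E : CircEquations Γ) :
    ∀ {m n : ℕ}, CircTerm Γ m n → CircTerm Γ m n → Prop
  | ofEq {m n : ℕ} {f g : CircTerm Γ m n} : E f g → CircRel E f g
  -- congruence
  | refl {m n : ℕ} (f : CircTerm Γ m n) : CircRel E f f
  | symm {m n : ℕ} {f g : CircTerm Γ m n} : CircRel E f g → CircRel E g f
  | trans {m n : ℕ} {f g h : CircTerm Γ m n} : CircRel E f g → CircRel E g h → CircRel E f h
  | comp_congr {m n k : ℕ} {f f' : CircTerm Γ m n} {g g' : CircTerm Γ n k} :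
      CircRel E f f' → CircRel E g g' → CircRel E (f.comp g) (f'.comp g')
  | tensor_congr {m n m' n' : ℕ} {f f' : CircTerm Γ m n} {g g' : CircTerm Γ m' n'} :
      CircRel E f f' → CircRel E g g' → CircRel E (f.tensor g) (f'.tensor g')
  -- category
  | id_comp {m n : ℕ} (f : CircTerm Γ m n) : CircRel E ((CircTerm.id m).comp f) f
  | comp_id {m n : ℕ} (f : CircTerm Γ m n) : CircRel E (f.comp (CircTerm.id n)) f
  | comp_assoc {m n k l : ℕ} (f : CircTerm Γ m n) (g : CircTerm Γ n k) (h : CircTerm Γ k l) :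
      CircRel E ((f.comp g).comp h) (f.comp (g.comp h))
  -- strict monoidal structure
  | id_tensor_id (m n : ℕ) :
      CircRel E ((CircTerm.id m).tensor (CircTerm.id n)) (CircTerm.id (m + n))
  | tensor_comp_tensor {m n k m' n' k' : ℕ} (f : CircTerm Γ m n) (g : CircTerm Γ n k)
      (f' : CircTerm Γ m' n') (g' : CircTerm Γ n' k') :
      CircRel E ((f.tensor f').comp (g.tensor g')) ((f.comp g).tensor (f'.comp g'))
  | tensor_assoc {m n m' n' m'' n'' : ℕ} (f : CircTerm Γ m n) (g : CircTerm Γ m' n')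
      (h : CircTerm Γ m'' n'') :
      CircRel E (((f.tensor g).tensor h).comp (castId (Nat.add_assoc n n' n'')))
        ((castId (Nat.add_assoc m m' m'')).comp (f.tensor (g.tensor h)))
  | unit_tensor {m n : ℕ} (f : CircTerm Γ m n) :
      CircRel E (((CircTerm.id 0).tensor f).comp (castId (Nat.zero_add n)))
        ((castId (Nat.zero_add m)).comp f)
  | tensor_unit {m n : ℕ} (f : CircTerm Γ m n) :
      CircRel E ((f.tensor (CircTerm.id 0)).comp (castId (Nat.add_zero n)))
        ((castId (Nat.add_zero m)).comp f)
  -- symmetry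
  | twist_twist (m n : ℕ) :
      CircRel E ((twist m n).comp (twist n m)) (CircTerm.id (m + n))
  | twist_natural {m n m' n' : ℕ} (f : CircTerm Γ m n) (g : CircTerm Γ m' n') :
      CircRel E ((f.tensor g).comp (twist n n')) ((twist m m').comp (g.tensor f))
  | hexagon (a b c : ℕ) :
      CircRel E
        (((castId (Nat.add_assoc a b c)).comp (twist a (b + c))).comp
          (castId (Nat.add_assoc b c a)))
        ((((twist a b).tensor (CircTerm.id c)).comp (castId (Nat.add_assoc b a c))).comp
          ((CircTerm.id b).tensor (twist a c)))
  -- cartesian structure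
  | copy_comm (n : ℕ) : CircRel E ((copy n).comp (twist n n)) (copy n)
  | copy_assoc (n : ℕ) :
      CircRel E
        (((copy n).comp ((copy n).tensor (CircTerm.id n))).comp (castId (Nat.add_assoc n n n)))
        ((copy n).comp ((CircTerm.id n).tensor (copy n)))
  | copy_counit (n : ℕ) :
      CircRel E (((copy n).comp ((CircTerm.id n).tensor (discard n))).comp
        (castId (Nat.add_zero n))) (CircTerm.id n)
  | copy_natural {m n : ℕ} (f : CircTerm Γ m n) :
      CircRel E (f.comp (copy n)) ((copy m).comp (f.tensor f))
  | discard_natural {m n : ℕ} (f : CircTerm Γ m n) :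
      CircRel E (f.comp (discard n)) (discard m)
  | copy_tensor (m n : ℕ) :
      CircRel E (copy (m + n)) (((copy m).tensor (copy n)).comp (interchange m m n n))
  | discard_unit : CircRel E (discard 0) (CircTerm.id 0)
  -- left-additive structure
  | add_comm (n : ℕ) : CircRel E ((twist n n).comp (add n)) (add n)
  | add_assoc (n : ℕ) :
      CircRel E (((add n).tensor (CircTerm.id n)).comp (add n))
        ((castId (Nat.add_assoc n n n)).comp (((CircTerm.id n).tensor (add n)).comp (add n)))
  | add_zero (n : ℕ) :
      CircRel E (((CircTerm.id n).tensor (zero n)).comp (add n)) (castId (Nat.add_zero n))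
  | add_tensor (m n : ℕ) :
      CircRel E (add (m + n)) ((interchange m n m n).comp ((add m).tensor (add n)))
  | zero_tensor (m n : ℕ) :
      CircRel E (zero (m + n)) ((castId (Nat.zero_add 0).symm).comp ((zero m).tensor (zero n)))
  -- multiplicative structure
  | mul_comm (n : ℕ) : CircRel E ((twist n n).comp (mul n)) (mul n)
  | mul_assoc (n : ℕ) :
      CircRel E (((mul n).tensor (CircTerm.id n)).comp (mul n))
        ((castId (Nat.add_assoc n n n)).comp (((CircTerm.id n).tensor (mul n)).comp (mul n)))
  | mul_one (n : ℕ) :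
      CircRel E (((CircTerm.id n).tensor (one n)).comp (mul n)) (castId (Nat.add_zero n))
  | mul_tensor (m n : ℕ) :
      CircRel E (mul (m + n)) ((interchange m n m n).comp ((mul m).tensor (mul n)))
  | one_tensor (m n : ℕ) :
      CircRel E (one (m + n)) ((castId (Nat.zero_add 0).symm).comp ((one m).tensor (one n)))
  -- distributivity and annihilation
  | distrib (n : ℕ) :
      CircRel E (((add n).tensor (CircTerm.id n)).comp (mul n))
        (((CircTerm.id (n + n)).tensor (copy n)).comp
          ((interchange n n n n).comp (((mul n).tensor (mul n)).comp (add n))))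
  | mul_zero (n : ℕ) :
      CircRel E (((CircTerm.id n).tensor (zero n)).comp (mul n)) ((discard (n + 0)).comp (zero n))

/-- Renaming of generators preserves derivable equality. -/
theorem CircRel.map {Γ Γ' : ℕ → ℕ → Type u} {E : CircEquations Γ} {E' : CircEquations Γ'}
    (φ : ∀ ⦃m n : ℕ⦄, Γ m n → Γ' m n)
    (hE : ∀ {m n : ℕ} (f g : CircTerm Γ m n), E f g →
      CircRel E' (CircTerm.map φ f) (CircTerm.map φ g))
    {m n : ℕ} {f g : CircTerm Γ m n} (h : CircRel E f g) :
    CircRel E' (CircTerm.map φ f) (CircTerm.map φ g) := by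
  induction h with
  | ofEq h => exact hE _ _ h
  | symm _ ih => exact ih.symm
  | trans _ _ ih ih' => exact ih.trans ih'
  | comp_congr _ _ ih ih' => exact ih.comp_congr ih'
  | tensor_congr _ _ ih ih' => exact ih.tensor_congr ih'
  | refl => exact .refl _
  | id_comp => exact .id_comp _
  | comp_id => exact .comp_id _
  | comp_assoc => exact .comp_assoc _ _ _
  | id_tensor_id => exact .id_tensor_id _ _
  | tensor_comp_tensor => exact .tensor_comp_tensor _ _ _ _
  | tensor_assoc =>
    simp only [CircTerm.map, CircTerm.map_castId]
    exact .tensor_assoc _ _ _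
  | unit_tensor =>
    simp only [CircTerm.map, CircTerm.map_castId]
    exact .unit_tensor _
  | tensor_unit =>
    simp only [CircTerm.map, CircTerm.map_castId]
    exact .tensor_unit _
  | twist_twist => exact .twist_twist _ _
  | twist_natural => exact .twist_natural _ _
  | hexagon =>
    simp only [CircTerm.map, CircTerm.map_castId]
    exact .hexagon _ _ _
  | copy_comm => exact .copy_comm _
  | copy_assoc =>
    simp only [CircTerm.map, CircTerm.map_castId]
    exact .copy_assoc _
  | copy_counit =>
    simp only [CircTerm.map, CircTerm.map_castId]
    exact .copy_counit _
  | copy_natural => exact .copy_natural _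
  | discard_natural => exact .discard_natural _
  | copy_tensor =>
    simp only [CircTerm.map, CircTerm.interchange, CircTerm.map_castId]
    exact .copy_tensor _ _
  | discard_unit => exact .discard_unit
  | add_comm => exact .add_comm _
  | add_assoc =>
    simp only [CircTerm.map, CircTerm.map_castId]
    exact .add_assoc _
  | add_zero =>
    simp only [CircTerm.map, CircTerm.map_castId]
    exact .add_zero _
  | add_tensor =>
    simp only [CircTerm.map, CircTerm.interchange, CircTerm.map_castId]
    exact .add_tensor _ _
  | zero_tensor =>
    simp only [CircTerm.map, CircTerm.map_castId]
    exact .zero_tensor _ _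
  | mul_comm => exact .mul_comm _
  | mul_assoc =>
    simp only [CircTerm.map, CircTerm.map_castId]
    exact .mul_assoc _
  | mul_one =>
    simp only [CircTerm.map, CircTerm.map_castId]
    exact .mul_one _
  | mul_tensor =>
    simp only [CircTerm.map, CircTerm.interchange, CircTerm.map_castId]
    exact .mul_tensor _ _
  | one_tensor =>
    simp only [CircTerm.map, CircTerm.map_castId]
    exact .one_tensor _ _
  | distrib =>
    simp only [CircTerm.map, CircTerm.interchange, CircTerm.map_castId]
    exact .distrib _
  | mul_zero => exact .mul_zero _

/-- The setoid of derivable equality on terms `m → n`. -/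
def CircRel.setoid {Γ : ℕ → ℕ → Type u} (E : CircEquations Γ) (m n : ℕ) :
    Setoid (CircTerm Γ m n) :=
  ⟨fun f g => CircRel E f g, ⟨CircRel.refl, CircRel.symm, CircRel.trans⟩⟩

/-- Objects of the cartesian distributive category presented by one generating object, the
generating morphisms `Γ` and the equations `E`. -/
@[ext]
structure Circ {Γ : ℕ → ℕ → Type u} (E : CircEquations Γ) : Type where
  /-- the length of the word -/
  len : ℕ

namespace Circ

variable {Γ : ℕ → ℕ → Type u} {E : CircEquations Γ}

instance : Category.{u} (Circ E) where
  Hom X Y := Quotient (CircRel.setoid E X.len Y.len)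
  id X := Quotient.mk _ (CircTerm.id X.len)
  comp f g := Quotient.map₂ CircTerm.comp
    (fun _ _ h _ _ h' => CircRel.comp_congr h h') f g
  id_comp f := Quotient.inductionOn f fun f => Quotient.sound (.id_comp f)
  comp_id f := Quotient.inductionOn f fun f => Quotient.sound (.comp_id f)
  assoc f g h := Quotient.inductionOn₃ f g h fun f g h => Quotient.sound (.comp_assoc f g h)

/-- The morphism represented by a term. -/
def ofTerm (E : CircEquations Γ) {m n : ℕ} (t : CircTerm Γ m n) :
    (⟨m⟩ : Circ E) ⟶ (⟨n⟩ : Circ E) :=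
  Quotient.mk _ t

/-- The identity morphism between equal words. -/
def castHom (E : CircEquations Γ) {m n : ℕ} (h : m = n) : (⟨m⟩ : Circ E) ⟶ ⟨n⟩ :=
  ofTerm E (CircTerm.castId h)

/-- The parallel composite of morphisms. -/
def par {X Y X' Y' : Circ E} (f : X ⟶ Y) (g : X' ⟶ Y') :
    (⟨X.len + X'.len⟩ : Circ E) ⟶ ⟨Y.len + Y'.len⟩ :=
  Quotient.map₂ CircTerm.tensor (fun _ _ h _ _ h' => CircRel.tensor_congr h h') f g

theorem castHom_rfl (n : ℕ) : castHom E (rfl : n = n) = 𝟙 _ := rfl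

theorem par_id (X Y : Circ E) : par (𝟙 X) (𝟙 Y) = 𝟙 _ :=
  Quotient.sound (.id_tensor_id _ _)

theorem par_comp_par {X Y Z X' Y' Z' : Circ E} (f : X ⟶ Y) (f' : X' ⟶ Y') (g : Y ⟶ Z)
    (g' : Y' ⟶ Z') : par f f' ≫ par g g' = par (f ≫ g) (f' ≫ g') := by
  induction f using Quotient.inductionOn
  induction f' using Quotient.inductionOn
  induction g using Quotient.inductionOn
  induction g' using Quotient.inductionOn
  exact Quotient.sound (.tensor_comp_tensor _ _ _ _)

theorem castHom_comp {m n k : ℕ} (h : m = n) (h' : n = k) :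
    castHom E h ≫ castHom E h' = castHom E (h.trans h') := by
  subst h h'; exact Category.id_comp _

theorem castHom_comp_assoc {m n k : ℕ} (h : m = n) (h' : n = k) {Z : Circ E} (f : ⟨k⟩ ⟶ Z) :
    castHom E h ≫ castHom E h' ≫ f = castHom E (h.trans h') ≫ f := by
  rw [← Category.assoc, castHom_comp]

theorem par_castHom {m n m' n' : ℕ} (h : m = n) (h' : m' = n') :
    par (castHom E h) (castHom E h') = castHom E (congrArg₂ (· + ·) h h') := by
  subst h h'; exact par_id _ _

theorem par_id_castHom (X : Circ E) {m n : ℕ} (h : m = n) :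
    par (𝟙 X) (castHom E h) = castHom E (congrArg (X.len + ·) h) :=
  par_castHom rfl h

theorem par_castHom_id {m n : ℕ} (h : m = n) (X : Circ E) :
    par (castHom E h) (𝟙 X) = castHom E (congrArg (· + X.len) h) :=
  par_castHom h rfl

/-- The identity between equal words, as an isomorphism. -/
def castIso (E : CircEquations Γ) {m n : ℕ} (h : m = n) : (⟨m⟩ : Circ E) ≅ ⟨n⟩ where
  hom := castHom E h
  inv := castHom E h.symm
  hom_inv_id := castHom_comp _ _
  inv_hom_id := castHom_comp _ _

instance : MonoidalCategoryStruct (Circ E) where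
  tensorObj X Y := ⟨X.len + Y.len⟩
  tensorUnit := ⟨0⟩
  tensorHom f g := par f g
  whiskerLeft X _ _ f := par (𝟙 X) f
  whiskerRight f X := par f (𝟙 X)
  associator X Y Z := castIso E (Nat.add_assoc X.len Y.len Z.len)
  leftUnitor X := castIso E (Nat.zero_add X.len)
  rightUnitor X := castIso E (Nat.add_zero X.len)

instance : MonoidalCategory (Circ E) := .ofTensorHom
  (id_tensorHom_id := par_id)
  (id_tensorHom := fun _ _ _ _ => rfl)
  (tensorHom_id := fun _ _ => rfl)
  (tensorHom_comp_tensorHom := fun f f' g g' => par_comp_par f f' g g')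
  (associator_naturality := fun f g h =>
    Quotient.inductionOn₃ f g h fun _ _ _ => Quotient.sound (.tensor_assoc _ _ _))
  (leftUnitor_naturality := fun f =>
    Quotient.inductionOn f fun _ => Quotient.sound (.unit_tensor _))
  (rightUnitor_naturality := fun f =>
    Quotient.inductionOn f fun _ => Quotient.sound (.tensor_unit _))
  (pentagon := fun W X Y Z => by
    change par (castHom E _) (𝟙 Z) ≫ castHom E _ ≫ par (𝟙 W) (castHom E _) =
      castHom E _ ≫ castHom E _
    rw [par_id_castHom, par_castHom_id]
    erw [castHom_comp, castHom_comp, castHom_comp])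
  (triangle := fun X Y => by
    change castHom E _ ≫ par (𝟙 X) (castHom E _) = par (castHom E _) (𝟙 Y)
    rw [par_id_castHom, par_castHom_id]
    erw [castHom_comp])

/-- The symmetry of two words. -/
def twistHom (X Y : Circ E) : X ⊗ Y ⟶ Y ⊗ X := ofTerm E (CircTerm.twist X.len Y.len)

theorem twistHom_twistHom (X Y : Circ E) : twistHom X Y ≫ twistHom Y X = 𝟙 (X ⊗ Y) :=
  Quotient.sound (.twist_twist _ _)

theorem twistHom_natural {X Y X' Y' : Circ E} (f : X ⟶ Y) (g : X' ⟶ Y') :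
    (f ⊗ₘ g) ≫ twistHom Y Y' = twistHom X X' ≫ (g ⊗ₘ f) :=
  Quotient.inductionOn₂ f g fun _ _ => Quotient.sound (.twist_natural _ _)

theorem twistHom_hexagon (X Y Z : Circ E) :
    (α_ X Y Z).hom ≫ twistHom X (Y ⊗ Z) ≫ (α_ Y Z X).hom =
      (twistHom X Y ▷ Z) ≫ (α_ Y X Z).hom ≫ (Y ◁ twistHom X Z) := by
  rw [← Category.assoc, ← Category.assoc]
  exact Quotient.sound (.hexagon _ _ _)

/-- The symmetry of two words, as an isomorphism. -/
def twistIso (X Y : Circ E) : X ⊗ Y ≅ Y ⊗ X :=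
  ⟨twistHom X Y, twistHom Y X, twistHom_twistHom X Y, twistHom_twistHom Y X⟩

instance : SymmetricCategory (Circ E) where
  braiding := twistIso
  braiding_naturality_right X _ _ f := twistHom_natural (𝟙 X) f
  braiding_naturality_left f Z := twistHom_natural f (𝟙 Z)
  hexagon_forward := twistHom_hexagon
  hexagon_reverse X Y Z := by
    have h := twistHom_hexagon Z X Y
    have h1 : (α_ Z X Y ≪≫ twistIso Z (X ⊗ Y) ≪≫ α_ X Y Z) =
        (whiskerRightIso (twistIso Z X) Y ≪≫ α_ X Z Y ≪≫ whiskerLeftIso X (twistIso Z Y)) :=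
      Iso.ext h
    have h2 := congrArg Iso.inv h1
    simp only [Iso.trans_inv, whiskerRightIso_inv, whiskerLeftIso_inv, Category.assoc] at h2
    exact h2
  symmetry := twistHom_twistHom

/-- Copying. -/
def copyHom (X : Circ E) : X ⟶ X ⊗ X := ofTerm E (CircTerm.copy X.len)

/-- Discarding. -/
def discardHom (X : Circ E) : X ⟶ 𝟙_ (Circ E) := ofTerm E (CircTerm.discard X.len)

theorem eq_discardHom {X : Circ E} (f : X ⟶ 𝟙_ (Circ E)) : f = discardHom X := by
  have h1 : f ≫ discardHom (𝟙_ (Circ E)) = discardHom X :=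
    Quotient.inductionOn f fun _ => Quotient.sound (.discard_natural _)
  have h2 : discardHom (𝟙_ (Circ E)) = 𝟙 _ := Quotient.sound .discard_unit
  rw [← h1, h2, Category.comp_id]

theorem copyHom_natural {X Y : Circ E} (f : X ⟶ Y) :
    f ≫ copyHom Y = copyHom X ≫ (f ⊗ₘ f) :=
  Quotient.inductionOn f fun _ => Quotient.sound (.copy_natural _)

theorem copyHom_comm (X : Circ E) : copyHom X ≫ (β_ X X).hom = copyHom X :=
  Quotient.sound (.copy_comm _)

theorem copyHom_fst (X : Circ E) : copyHom X ≫ (X ◁ discardHom X) ≫ (ρ_ X).hom = 𝟙 X := by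
  rw [← Category.assoc]
  exact Quotient.sound (.copy_counit _)

theorem copyHom_snd (X : Circ E) : copyHom X ≫ (discardHom X ▷ X) ≫ (λ_ X).hom = 𝟙 X := by
  rw [← copyHom_comm, Category.assoc, ← BraidedCategory.braiding_naturality_right_assoc,
    braiding_leftUnitor, copyHom_fst]

theorem ofTerm_interchange (a b c d : ℕ) :
    ofTerm E (CircTerm.interchange a b c d) =
      tensorμ (⟨a⟩ : Circ E) ⟨b⟩ ⟨c⟩ ⟨d⟩ := by
  change (castHom E _ ≫ par (𝟙 (⟨a⟩ : Circ E)) (par (twistHom (⟨b⟩ : Circ E) ⟨c⟩) (𝟙 (⟨d⟩ : Circ E)))) ≫ castHom E _ =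
    castHom E _ ≫ par (𝟙 (⟨a⟩ : Circ E)) (castHom E _) ≫ par (𝟙 (⟨a⟩ : Circ E)) (par (twistHom (⟨b⟩ : Circ E) ⟨c⟩) (𝟙 (⟨d⟩ : Circ E))) ≫
      par (𝟙 (⟨a⟩ : Circ E)) (castHom E _) ≫ castHom E _
  rw [par_id_castHom, par_id_castHom]
  erw [castHom_comp, castHom_comp_assoc]
  rw [Category.assoc]

theorem copyHom_tensor (X Y : Circ E) :
    copyHom (X ⊗ Y) = (copyHom X ⊗ₘ copyHom Y) ≫ tensorμ X X Y Y := by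
  rw [← ofTerm_interchange]
  exact Quotient.sound (.copy_tensor _ _)

/-- The first projection. -/
def fstHom (X Y : Circ E) : X ⊗ Y ⟶ X := (X ◁ discardHom Y) ≫ (ρ_ X).hom

/-- The second projection. -/
def sndHom (X Y : Circ E) : X ⊗ Y ⟶ Y := (discardHom X ▷ Y) ≫ (λ_ Y).hom

theorem copyHom_fst_snd (X Y : Circ E) :
    copyHom (X ⊗ Y) ≫ (fstHom X Y ⊗ₘ sndHom X Y) = 𝟙 (X ⊗ Y) := by
  have hX := copyHom_fst X
  have hY := copyHom_snd Y
  calc copyHom (X ⊗ Y) ≫ (fstHom X Y ⊗ₘ sndHom X Y)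
      = (copyHom X ⊗ₘ copyHom Y) ≫ (tensorμ X X Y Y ≫
          ((𝟙 X ⊗ₘ discardHom Y) ⊗ₘ (discardHom X ⊗ₘ 𝟙 Y))) ≫
          ((ρ_ X).hom ⊗ₘ (λ_ Y).hom) := by
        rw [copyHom_tensor, fstHom, sndHom, ← tensorHom_comp_tensorHom, id_tensorHom, tensorHom_id]
        simp only [Category.assoc]
    _ = (copyHom X ⊗ₘ copyHom Y) ≫ ((𝟙 X ⊗ₘ discardHom X) ⊗ₘ (discardHom Y ⊗ₘ 𝟙 Y)) ≫
          ((ρ_ X).hom ⊗ₘ (λ_ Y).hom) := by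
        rw [← tensorμ_natural, Category.assoc, tensorμ_unit_unit]
    _ = 𝟙 (X ⊗ Y) := by
        rw [tensorHom_comp_tensorHom, tensorHom_comp_tensorHom, id_tensorHom, tensorHom_id, hX, hY,
          id_tensorHom_id]

theorem copyHom_lift_fst {T X Y : Circ E} (f : T ⟶ X) (g : T ⟶ Y) :
    (copyHom T ≫ (f ⊗ₘ g)) ≫ fstHom X Y = f := by
  rw [fstHom, ← id_tensorHom, Category.assoc, tensorHom_comp_tensorHom_assoc, Category.comp_id,
    eq_discardHom (g ≫ discardHom Y), MonoidalCategory.tensorHom_def', Category.assoc, rightUnitor_naturality,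
    reassoc_of% copyHom_fst]

theorem copyHom_lift_snd {T X Y : Circ E} (f : T ⟶ X) (g : T ⟶ Y) :
    (copyHom T ≫ (f ⊗ₘ g)) ≫ sndHom X Y = g := by
  rw [sndHom, ← tensorHom_id, Category.assoc, tensorHom_comp_tensorHom_assoc, Category.comp_id,
    eq_discardHom (f ≫ discardHom X), MonoidalCategory.tensorHom_def, Category.assoc, leftUnitor_naturality,
    reassoc_of% copyHom_snd]

theorem eq_copyHom_lift {T X Y : Circ E} (m : T ⟶ X ⊗ Y) (f : T ⟶ X) (g : T ⟶ Y)
    (hf : m ≫ fstHom X Y = f) (hg : m ≫ sndHom X Y = g) : m = copyHom T ≫ (f ⊗ₘ g) := by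
  rw [← hf, ← hg, ← tensorHom_comp_tensorHom, ← Category.assoc, ← copyHom_natural,
    Category.assoc, copyHom_fst_snd, Category.comp_id]

instance : CartesianMonoidalCategory (Circ E) where
  isTerminalTensorUnit := .ofUniqueHom discardHom fun _ f => eq_discardHom f
  fst := fstHom
  snd := sndHom
  fst_def _ _ := rfl
  snd_def _ _ := rfl
  tensorProductIsBinaryProduct _ _ := Limits.BinaryFan.IsLimit.mk _
    (fun f g => copyHom _ ≫ (f ⊗ₘ g)) copyHom_lift_fst copyHom_lift_snd
    (fun f g m hf hg => eq_copyHom_lift m f g hf hg)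

theorem lift_id_id (X : Circ E) : lift (𝟙 X) (𝟙 X) = copyHom X := by
  change copyHom X ≫ (𝟙 X ⊗ₘ 𝟙 X) = copyHom X
  rw [id_tensorHom_id, Category.comp_id]

instance : CartesianDistributive (Circ E) where
  add X := ofTerm E (CircTerm.add X.len)
  zero X := ofTerm E (CircTerm.zero X.len)
  add_comm X := Quotient.sound (.add_comm _)
  add_assoc X := Quotient.sound (.add_assoc _)
  add_zero X := Quotient.sound (.add_zero _)
  add_tensor X Y := by
    rw [← ofTerm_interchange]
    exact Quotient.sound (.add_tensor _ _)
  zero_tensor X Y := Quotient.sound (.zero_tensor _ _)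
  mul X := ofTerm E (CircTerm.mul X.len)
  one X := ofTerm E (CircTerm.one X.len)
  mul_comm X := Quotient.sound (.mul_comm _)
  mul_assoc X := Quotient.sound (.mul_assoc _)
  mul_one X := Quotient.sound (.mul_one _)
  distrib X := by
    rw [← ofTerm_interchange, lift_id_id]
    exact Quotient.sound (.distrib _)
  mul_zero X := Quotient.sound (.mul_zero _)

/-- The morphisms represented by a term with renamed generators. -/
def mapHom {Γ' : ℕ → ℕ → Type u} {E' : CircEquations Γ'} (φ : ∀ ⦃m n : ℕ⦄, Γ m n → Γ' m n)
    (hE : ∀ {m n : ℕ} (f g : CircTerm Γ m n), E f g →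
      CircRel E' (CircTerm.map φ f) (CircTerm.map φ g))
    {m n : ℕ} (f : (⟨m⟩ : Circ E) ⟶ ⟨n⟩) : (⟨m⟩ : Circ E') ⟶ ⟨n⟩ :=
  Quotient.map (CircTerm.map φ) (fun _ _ h => CircRel.map φ hE h) f

end Circ

/-! ### Polynomial circuits -/

/-- Generating morphisms of polynomial circuits: a constant `0 → 1` for each `s : S`. -/
inductive PolyGen (S : Type u) : ℕ → ℕ → Type u
  | const (s : S) : PolyGen S 0 1

/-- Generating morphisms of polynomial circuits with a comparator. -/
inductive PolyEqGen (S : Type u) : ℕ → ℕ → Type u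
  | base {m n : ℕ} (g : PolyGen S m n) : PolyEqGen S m n
  | compare : PolyEqGen S (1 + 1) 1

open CircTerm in
/-- The equations on constants `c s : 0 → 1`, saying that `c` respects `0`, `+`, `1` and `*`. -/
inductive ConstEq {S : Type u} [CommSemiring S] {Γ : ℕ → ℕ → Type u} (c : S → CircTerm Γ 0 1) :
    ∀ ⦃m n : ℕ⦄, CircTerm Γ m n → CircTerm Γ m n → Prop
  | zero : ConstEq c (c 0) (CircTerm.zero 1)
  | add (s t : S) : ConstEq c
      ((castId (Nat.zero_add 0).symm).comp (((c s).tensor (c t)).comp (CircTerm.add 1)))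
      (c (s + t))
  | one : ConstEq c (c 1) (CircTerm.one 1)
  | mul (s t : S) : ConstEq c
      ((castId (Nat.zero_add 0).symm).comp (((c s).tensor (c t)).comp (CircTerm.mul 1)))
      (c (s * t))

/-- The constant `s` as a term of polynomial circuits. -/
def polyConst {S : Type u} (s : S) : CircTerm (PolyGen S) 0 1 := .gen (.const s)

/-- The constant `s` as a term of polynomial circuits with a comparator. -/
def polyEqConst {S : Type u} (s : S) : CircTerm (PolyEqGen S) 0 1 := .gen (.base (.const s))

/-- The comparator as a term. -/
def polyEqCompare (S : Type u) : CircTerm (PolyEqGen S) (1 + 1) 1 := .gen .compare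

open CircTerm in
/-- The equations of polynomial circuits with a comparator: those on constants, together with
`compare (s, s) = 1` and `compare (s, t) = 0` for `s ≠ t`. -/
inductive PolyEqEq (S : Type u) [CommSemiring S] :
    ∀ ⦃m n : ℕ⦄, CircTerm (PolyEqGen S) m n → CircTerm (PolyEqGen S) m n → Prop
  | const {m n : ℕ} {f g : CircTerm (PolyEqGen S) m n} :
      ConstEq polyEqConst f g → PolyEqEq S f g
  | compare_self (s : S) : PolyEqEq S
      ((castId (Nat.zero_add 0).symm).comp
        (((polyEqConst s).tensor (polyEqConst s)).comp (polyEqCompare S)))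
      (CircTerm.one 1)
  | compare_ne (s t : S) (h : s ≠ t) : PolyEqEq S
      ((castId (Nat.zero_add 0).symm).comp
        (((polyEqConst s).tensor (polyEqConst t)).comp (polyEqCompare S)))
      (CircTerm.zero 1)

/-- The category of polynomial circuits over `S`. -/
abbrev PolyCirc (S : Type u) [CommSemiring S] : Type :=
  Circ (Γ := PolyGen S) (ConstEq polyConst)

/-- The category of polynomial circuits with a comparator over `S`. -/
abbrev PolyCircEq (S : Type u) [CommSemiring S] : Type :=
  Circ (Γ := PolyEqGen S) (PolyEqEq S)

/-- The constant `s : 0 → 1` in polynomial circuits. -/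
def PolyCirc.const {S : Type u} [CommSemiring S] (s : S) :
    𝟙_ (PolyCirc S) ⟶ (⟨1⟩ : PolyCirc S) :=
  Circ.ofTerm _ (polyConst s)

/-- The constant `s : 0 → 1` in polynomial circuits with a comparator. -/
def PolyCircEq.const {S : Type u} [CommSemiring S] (s : S) :
    𝟙_ (PolyCircEq S) ⟶ (⟨1⟩ : PolyCircEq S) :=
  Circ.ofTerm _ (polyEqConst s)

/-- The comparator `1 ⊗ 1 → 1`. -/
def PolyCircEq.compare (S : Type u) [CommSemiring S] :
    (⟨1⟩ : PolyCircEq S) ⊗ (⟨1⟩ : PolyCircEq S) ⟶ (⟨1⟩ : PolyCircEq S) :=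
  Circ.ofTerm _ (polyEqCompare S)

/-- The inclusion of polynomial circuits in polynomial circuits with a comparator, identity on
objects and on the common generators. -/
def PolyCircEq.incl (S : Type u) [CommSemiring S] : PolyCirc S ⥤ PolyCircEq S where
  obj X := ⟨X.len⟩
  map f := Circ.mapHom (fun _ _ g => PolyEqGen.base g)
    (fun _ _ h => .ofEq (.const (by cases h <;>
      simp only [CircTerm.map, CircTerm.map_castId, polyConst] <;> constructor))) f
  map_id _ := rfl
  map_comp f g := Quotient.inductionOn₂ f g fun _ _ => rfl

/-! ### Algebra of generalized elements -/

namespace ReverseDerivative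

section LeftAdditive

variable {C : Type u} [Category.{v} C] [CartesianMonoidalCategory C] [SymmetricCategory C]
  [CartesianLeftAdditive C]

/-! A reverse derivative on a presented category is forced by its values on generators: the chain
rule and the tensor rule define it by recursion on terms (`Circ.rev`). Two things must be checked:
that it descends to the quotient, and that the result satisfies the axioms.

Descent (`Circ.rev_congr`). Every law of cartesian distributive categories must be respected. Each
becomes an identity between generalized elements, which form a commutative monoid, or a commutative
semiring when there is multiplication, under the pointwise operations. Naturality of copying and
discarding needs the reverse derivative of every term to be additive in the change, so this is
proved first, on terms (`Circ.rev_isAdditive`). The remaining equations, on constants and on the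
comparator, relate terms with no inputs. The reverse derivative of such a term is a map into the
terminal object, so these equations hold trivially whatever `R[compare]` is; this is why so crude a
choice as `R[+]` is consistent.

Axioms. The structural ones hold by construction. For linearity of change and symmetry, the reverse
chain rule and additivity give a chain rule for the forward derivative (`lift_comp_fwd_comp`). With
it both properties are stable under composition and tensor, hence need checking only on generators.
There the reverse derivatives are zero, linear, or the product rule `(y * d, x * d)`. Both
properties of a morphism depend only on its reverse derivative, so `compare` inherits them from
addition.

Compatibility with the inclusion holds because each clause of the recursion is built from structure
that renaming generators preserves (`Circ.mapHom_rev`). -/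

theorem lift_comp_add_comm {X Y : C} (f g : X ⟶ Y) :
    lift f g ≫ CartesianLeftAdditive.add Y = lift g f ≫ CartesianLeftAdditive.add Y := by
  rw [← lift_braiding_hom, Category.assoc, CartesianLeftAdditive.add_comm]

theorem lift_comp_add_zero {X Y : C} (f : X ⟶ Y) :
    lift f (zeroHom X Y) ≫ CartesianLeftAdditive.add Y = f := by
  have h := congrArg (fun k => lift f (toUnit X) ≫ k) (CartesianLeftAdditive.add_zero Y)
  simpa [zeroHom] using h

theorem lift_comp_add_assoc {X Y : C} (f g h : X ⟶ Y) :
    lift (lift f g ≫ CartesianLeftAdditive.add Y) h ≫ CartesianLeftAdditive.add Y =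
      lift f (lift g h ≫ CartesianLeftAdditive.add Y) ≫ CartesianLeftAdditive.add Y := by
  have h := congrArg (fun k => lift (lift f g) h ≫ k) (CartesianLeftAdditive.add_assoc Y)
  simpa using h

-- Pointwise operations on hom-sets turn diagrammatic identities into computations in commutative
-- monoids, and later in semirings, where `simp` and `ring` apply.
scoped instance homAdd (X Y : C) : Add (X ⟶ Y) :=
  ⟨fun f g => lift f g ≫ CartesianLeftAdditive.add Y⟩

scoped instance homZero (X Y : C) : Zero (X ⟶ Y) := ⟨zeroHom X Y⟩

/-- The generalized elements of an object of a cartesian left-additive category are a commutative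
monoid. -/
scoped instance homAddCommMonoid (X Y : C) : AddCommMonoid (X ⟶ Y) where
  add_comm := lift_comp_add_comm
  add_zero := lift_comp_add_zero
  zero_add f := (lift_comp_add_comm _ _).trans (lift_comp_add_zero f)
  add_assoc := lift_comp_add_assoc
  nsmul := nsmulRec

theorem add_def {X Y : C} (f g : X ⟶ Y) : f + g = lift f g ≫ CartesianLeftAdditive.add Y := rfl

theorem zeroHom_eq (X Y : C) : zeroHom X Y = 0 := rfl

@[simp]
theorem lift_comp_add {X Y : C} (f g : X ⟶ Y) :
    lift f g ≫ CartesianLeftAdditive.add Y = f + g := rfl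

theorem comp_add_eq {X Y : C} (f : X ⟶ Y ⊗ Y) :
    f ≫ CartesianLeftAdditive.add Y = f ≫ fst Y Y + f ≫ snd Y Y := by
  rw [add_def, lift_comp_fst_snd]

theorem add_eq (Y : C) : CartesianLeftAdditive.add Y = fst Y Y + snd Y Y := by
  rw [add_def, lift_fst_snd, Category.id_comp]

theorem comp_zero_eq {X Y : C} (f : X ⟶ 𝟙_ C) : f ≫ CartesianLeftAdditive.zero Y = 0 := by
  rw [toUnit_unique f (toUnit X)]; rfl

theorem zero_eq (Y : C) : CartesianLeftAdditive.zero Y = 0 := by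
  rw [← comp_zero_eq (𝟙 _), Category.id_comp]

@[simp]
-- Left additivity: substitution into a pointwise sum. Postcomposition is not additive in general,
-- only for special maps such as the projections below.
theorem comp_hom_add {W X Y : C} (x : W ⟶ X) (f g : X ⟶ Y) : x ≫ (f + g) = x ≫ f + x ≫ g := by
  rw [add_def, add_def, comp_lift_assoc]

@[simp]
theorem comp_hom_zero {W X : C} (x : W ⟶ X) (Y : C) : x ≫ (0 : X ⟶ Y) = 0 :=
  (Category.assoc _ _ _).symm.trans (comp_zero_eq _)

@[simp]
-- This is where the coherence `add_tensor`, addition on a product being componentwise, enters.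
theorem hom_add_fst {X Y Z : C} (f g : X ⟶ Y ⊗ Z) :
    (f + g) ≫ fst Y Z = f ≫ fst Y Z + g ≫ fst Y Z := by
  rw [add_def, CartesianLeftAdditive.add_tensor]
  simp [comp_add_eq]

@[simp]
theorem hom_add_snd {X Y Z : C} (f g : X ⟶ Y ⊗ Z) :
    (f + g) ≫ snd Y Z = f ≫ snd Y Z + g ≫ snd Y Z := by
  rw [add_def, CartesianLeftAdditive.add_tensor]
  simp [comp_add_eq]

@[simp]
theorem hom_zero_fst {X Y Z : C} : (0 : X ⟶ Y ⊗ Z) ≫ fst Y Z = 0 := by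
  rw [← zeroHom_eq, zeroHom, CartesianLeftAdditive.zero_tensor]
  simp [comp_zero_eq]

@[simp]
theorem hom_zero_snd {X Y Z : C} : (0 : X ⟶ Y ⊗ Z) ≫ snd Y Z = 0 := by
  rw [← zeroHom_eq, zeroHom, CartesianLeftAdditive.zero_tensor]
  simp [comp_zero_eq]

theorem lift_add_lift {X Y Z : C} (f f' : X ⟶ Y) (g g' : X ⟶ Z) :
    lift f g + lift f' g' = lift (f + f') (g + g') := by
  ext <;> simp

theorem lift_zero_zero (X Y Z : C) : lift (0 : X ⟶ Y) (0 : X ⟶ Z) = 0 := by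
  ext <;> simp

end LeftAdditive

/-! ### The semiring of generalized elements -/

section Distributive

variable {C : Type u} [Category.{v} C] [CartesianMonoidalCategory C] [SymmetricCategory C]
  [CartesianDistributive C]

theorem lift_comp_mul_comm {X Y : C} (f g : X ⟶ Y) :
    lift f g ≫ CartesianDistributive.mul Y = lift g f ≫ CartesianDistributive.mul Y := by
  rw [← lift_braiding_hom, Category.assoc, CartesianDistributive.mul_comm]

theorem lift_comp_mul_one {X Y : C} (f : X ⟶ Y) :
    lift f (toUnit X ≫ CartesianDistributive.one Y) ≫ CartesianDistributive.mul Y = f := by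
  have h := congrArg (fun k => lift f (toUnit X) ≫ k) (CartesianDistributive.mul_one Y)
  simpa using h

theorem lift_comp_mul_zero {X Y : C} (f : X ⟶ Y) :
    lift f 0 ≫ CartesianDistributive.mul Y = 0 := by
  have h := congrArg (fun k => lift f (toUnit X) ≫ k) (CartesianDistributive.mul_zero Y)
  simpa [comp_zero_eq] using h

theorem lift_add_comp_mul {X Y : C} (f g h : X ⟶ Y) :
    lift (f + g) h ≫ CartesianDistributive.mul Y =
      lift f h ≫ CartesianDistributive.mul Y + lift g h ≫ CartesianDistributive.mul Y := by
  have h := congrArg (fun k => lift (lift f g) h ≫ k) (CartesianDistributive.distrib Y)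
  simpa [comp_add_eq, tensorμ] using h

theorem lift_comp_mul_assoc {X Y : C} (f g h : X ⟶ Y) :
    lift (lift f g ≫ CartesianDistributive.mul Y) h ≫ CartesianDistributive.mul Y =
      lift f (lift g h ≫ CartesianDistributive.mul Y) ≫ CartesianDistributive.mul Y := by
  have h := congrArg (fun k => lift (lift f g) h ≫ k) (CartesianDistributive.mul_assoc Y)
  simpa using h

scoped instance homMul (X Y : C) : Mul (X ⟶ Y) :=
  ⟨fun f g => lift f g ≫ CartesianDistributive.mul Y⟩

scoped instance homOne (X Y : C) : One (X ⟶ Y) := ⟨toUnit X ≫ CartesianDistributive.one Y⟩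

/-- The generalized elements of an object of a cartesian distributive category are a commutative
semiring. -/
scoped instance homCommSemiring (X Y : C) : CommSemiring (X ⟶ Y) where
  mul_comm := lift_comp_mul_comm
  mul_one := lift_comp_mul_one
  one_mul f := (lift_comp_mul_comm _ _).trans (lift_comp_mul_one f)
  mul_assoc := lift_comp_mul_assoc
  mul_zero := lift_comp_mul_zero
  zero_mul f := (lift_comp_mul_comm _ _).trans (lift_comp_mul_zero f)
  right_distrib := lift_add_comp_mul
  left_distrib f g h := (lift_comp_mul_comm _ _).trans ((lift_add_comp_mul g h f).trans
    (congrArg₂ (· + ·) (lift_comp_mul_comm _ _) (lift_comp_mul_comm _ _)))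

theorem mul_def {X Y : C} (f g : X ⟶ Y) : f * g = lift f g ≫ CartesianDistributive.mul Y := rfl

@[simp]
theorem lift_comp_mul {X Y : C} (f g : X ⟶ Y) :
    lift f g ≫ CartesianDistributive.mul Y = f * g := rfl

theorem comp_mul_eq {X Y : C} (f : X ⟶ Y ⊗ Y) :
    f ≫ CartesianDistributive.mul Y = f ≫ fst Y Y * f ≫ snd Y Y := by
  rw [mul_def, lift_comp_fst_snd]

theorem comp_one_eq {X Y : C} (f : X ⟶ 𝟙_ C) : f ≫ CartesianDistributive.one Y = 1 := by
  rw [toUnit_unique f (toUnit X)]; rfl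

@[simp]
theorem comp_hom_mul {W X Y : C} (x : W ⟶ X) (f g : X ⟶ Y) : x ≫ (f * g) = (x ≫ f) * (x ≫ g) := by
  rw [mul_def, mul_def, comp_lift_assoc]

@[simp]
theorem comp_hom_one {W X : C} (x : W ⟶ X) (Y : C) : x ≫ (1 : X ⟶ Y) = 1 :=
  (Category.assoc _ _ _).symm.trans (comp_one_eq _)

theorem mulRev_eq (A : C) :
    mulRev A = lift ((fst _ _ ≫ snd _ _) * snd _ _) ((fst _ _ ≫ fst _ _) * snd _ _) := by
  ext <;> simp [mulRev, comp_mul_eq]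

end Distributive

end ReverseDerivative

/-! ### Reverse derivatives of composites and tensors -/

namespace ReverseDerivative

section LeftAdditive

variable {C : Type u} [Category.{v} C] [CartesianMonoidalCategory C]
  {X Y Z X' Y' Z' X'' Y'' : C}

/-- Testing on the generic pair of projections suffices, as their pairing is the identity. This lets
the identities below be verified on elements. -/
theorem hom_ext_lift {X Y Z : C} {r r' : X ⊗ Y ⟶ Z}
    (h : ∀ {T : C} (a : T ⟶ X) (b : T ⟶ Y), lift a b ≫ r = lift a b ≫ r') : r = r' := by
  simpa using h (fst X Y) (snd X Y)

/-- The reverse derivative of `f ≫ g`, given those of `f` and `g`. -/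
def revComp {X Y Z : C} (f : X ⟶ Y) (rf : X ⊗ Y ⟶ X) (rg : Y ⊗ Z ⟶ Y) : X ⊗ Z ⟶ X :=
  lift (fst X Z) ((f ▷ Z) ≫ rg) ≫ rf

@[simp]
theorem lift_comp_revComp {T X Y Z : C} (a : T ⟶ X) (c : T ⟶ Z) (f : X ⟶ Y) (rf : X ⊗ Y ⟶ X)
    (rg : Y ⊗ Z ⟶ Y) :
    lift a c ≫ revComp f rf rg = lift a (lift (a ≫ f) c ≫ rg) ≫ rf := by
  simp [revComp, comp_lift_assoc]

/-- For maps whose reverse derivative ignores the base point, the chain rule is plain composition in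
the opposite order. -/
theorem revComp_linear (f : X ⟶ Y) (k : Y ⟶ X) (l : Z ⟶ Y) :
    revComp f (snd X Y ≫ k) (snd Y Z ≫ l) = snd X Z ≫ l ≫ k :=
  hom_ext_lift fun a b => by simp

/-! ### Laws of symmetric monoidal categories, differentiated -/

theorem revComp_id_left (rf : X ⊗ Y ⟶ X) : revComp (𝟙 X) (snd X X) rf = rf :=
  hom_ext_lift fun a b => by simp

theorem revComp_id_right (f : X ⟶ Y) (rf : X ⊗ Y ⟶ X) : revComp f rf (snd Y Y) = rf :=
  hom_ext_lift fun a b => by simp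

theorem revComp_assoc {W : C} (f : W ⟶ X) (g : X ⟶ Y) (rf : W ⊗ X ⟶ W) (rg : X ⊗ Y ⟶ X)
    (rh : Y ⊗ Z ⟶ Y) :
    revComp (f ≫ g) (revComp f rf rg) rh = revComp f rf (revComp g rg rh) :=
  hom_ext_lift fun a b => by simp

variable [SymmetricCategory C]

/-- The reverse derivative of `f ⊗ₘ g`, given those of `f` and `g`. -/
def revTensor {X Y X' Y' : C} (rf : X ⊗ Y ⟶ X) (rg : X' ⊗ Y' ⟶ X') :
    (X ⊗ X') ⊗ (Y ⊗ Y') ⟶ X ⊗ X' :=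
  tensorμ X X' Y Y' ≫ (rf ⊗ₘ rg)

@[simp]
theorem lift_comp_revTensor {T X Y X' Y' : C} (a : T ⟶ X ⊗ X') (b : T ⟶ Y ⊗ Y')
    (rf : X ⊗ Y ⟶ X) (rg : X' ⊗ Y' ⟶ X') :
    lift a b ≫ revTensor rf rg =
      lift (lift (a ≫ fst _ _) (b ≫ fst _ _) ≫ rf) (lift (a ≫ snd _ _) (b ≫ snd _ _) ≫ rg) := by
  have h : lift a b ≫ tensorμ X X' Y Y' =
      lift (lift (a ≫ fst _ _) (b ≫ fst _ _)) (lift (a ≫ snd _ _) (b ≫ snd _ _)) := by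
    ext <;> simp
  rw [revTensor, reassoc_of% h, lift_map]

theorem revTensor_linear (k : Y ⟶ X) (l : Y' ⟶ X') :
    revTensor (snd X Y ≫ k) (snd X' Y' ≫ l) = snd (X ⊗ X') (Y ⊗ Y') ≫ (k ⊗ₘ l) :=
  hom_ext_lift fun a b => by ext <;> simp

/-- The shape of the derivative of an interchange: a twist in the middle, between two
reassociations. The maps `f` and `g` supply only base points, which are irrelevant here. -/
theorem revComp_revTensor_linear {W A D : C} (f : X ⟶ A ⊗ (Y' ⊗ D))
    (g : X ⟶ A ⊗ (Y ⊗ D)) (i : A ⊗ (Y ⊗ D) ⟶ X) (j : W ⟶ A ⊗ (Y' ⊗ D)) (k : Y' ⟶ Y) :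
    revComp f (revComp g (snd _ _ ≫ i) (revTensor (snd A A) (revTensor (snd Y Y' ≫ k) (snd D D))))
      (snd _ _ ≫ j) = snd _ _ ≫ (j ≫ (𝟙 A ⊗ₘ (k ⊗ₘ 𝟙 D))) ≫ i := by
  have h1 := revTensor_linear (X := Y) (X' := D) k (𝟙 D)
  have h2 := revTensor_linear (X := A) (X' := Y ⊗ D) (𝟙 A) (k ⊗ₘ 𝟙 D)
  simp only [Category.comp_id] at h1 h2
  rw [h1, h2, revComp_linear, revComp_linear, Category.assoc]

theorem revTensor_id (X Y : C) : revTensor (snd X X) (snd Y Y) = snd _ _ :=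
  hom_ext_lift fun a b => by simp

theorem revComp_revTensor (f : X ⟶ Y) (f' : X' ⟶ Y') (rf : X ⊗ Y ⟶ X) (rf' : X' ⊗ Y' ⟶ X')
    (rg : Y ⊗ Z ⟶ Y) (rg' : Y' ⊗ Z' ⟶ Y') :
    revComp (f ⊗ₘ f') (revTensor rf rf') (revTensor rg rg') =
      revTensor (revComp f rf rg) (revComp f' rf' rg') :=
  hom_ext_lift fun a b => by simp

theorem revTensor_assoc (f : X ⟶ Y) (g : X' ⟶ Y') (h : X'' ⟶ Y'') (rf : X ⊗ Y ⟶ X)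
    (rg : X' ⊗ Y' ⟶ X') (rh : X'' ⊗ Y'' ⟶ X'') :
    revComp ((f ⊗ₘ g) ⊗ₘ h) (revTensor (revTensor rf rg) rh) (snd _ _ ≫ (α_ Y Y' Y'').inv) =
      revComp (α_ X X' X'').hom (snd _ _ ≫ (α_ X X' X'').inv)
        (revTensor rf (revTensor rg rh)) :=
  hom_ext_lift fun a b => by ext <;> simp

theorem revTensor_unit_left (f : X ⟶ Y) (rf : X ⊗ Y ⟶ X) :
    revComp (𝟙 (𝟙_ C) ⊗ₘ f) (revTensor (snd _ _) rf) (snd _ _ ≫ (λ_ Y).inv) =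
      revComp (λ_ X).hom (snd _ _ ≫ (λ_ X).inv) rf :=
  hom_ext_lift fun a b => by ext; simp [leftUnitor_hom]

theorem revTensor_unit_right (f : X ⟶ Y) (rf : X ⊗ Y ⟶ X) :
    revComp (f ⊗ₘ 𝟙 (𝟙_ C)) (revTensor rf (snd _ _)) (snd _ _ ≫ (ρ_ Y).inv) =
      revComp (ρ_ X).hom (snd _ _ ≫ (ρ_ X).inv) rf :=
  hom_ext_lift fun a b => by ext; simp [rightUnitor_hom]

theorem revComp_braiding_braiding (X Y : C) :
    revComp (β_ X Y).hom (snd _ _ ≫ (β_ Y X).hom) (snd _ _ ≫ (β_ X Y).hom) = snd _ _ :=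
  hom_ext_lift fun a b => by simp

theorem revComp_braiding_natural (f : X ⟶ Y) (g : X' ⟶ Y') (rf : X ⊗ Y ⟶ X)
    (rg : X' ⊗ Y' ⟶ X') :
    revComp (f ⊗ₘ g) (revTensor rf rg) (snd _ _ ≫ (β_ Y' Y).hom) =
      revComp (β_ X X').hom (snd _ _ ≫ (β_ X' X).hom) (revTensor rg rf) :=
  hom_ext_lift fun a b => by ext <;> simp

theorem revComp_hexagon (X Y Z : C) :
    revComp ((α_ X Y Z).hom ≫ (β_ X (Y ⊗ Z)).hom)
        (revComp (α_ X Y Z).hom (snd _ _ ≫ (α_ X Y Z).inv) (snd _ _ ≫ (β_ (Y ⊗ Z) X).hom))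
        (snd _ _ ≫ (α_ Y Z X).inv) =
      revComp (((β_ X Y).hom ⊗ₘ 𝟙 Z) ≫ (α_ Y X Z).hom)
        (revComp ((β_ X Y).hom ⊗ₘ 𝟙 Z) (revTensor (snd _ _ ≫ (β_ Y X).hom) (snd Z Z))
          (snd _ _ ≫ (α_ Y X Z).inv))
        (revTensor (snd Y Y) (snd _ _ ≫ (β_ Z X).hom)) :=
  hom_ext_lift fun a b => by ext <;> simp

/-- Reverse differentiation exchanges addition and copying, so the laws of addition become laws of
the diagonal. Base points play no role, hence the arbitrary `f`. -/
theorem revComp_add_comm (f : X ⊗ X ⟶ X ⊗ X) :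
    revComp f (snd _ _ ≫ (β_ X X).hom) (snd _ X ≫ lift (𝟙 X) (𝟙 X)) =
      snd _ X ≫ lift (𝟙 X) (𝟙 X) :=
  hom_ext_lift fun a b => by simp

theorem revComp_add_assoc (f : (X ⊗ X) ⊗ X ⟶ X ⊗ X) (g : (X ⊗ X) ⊗ X ⟶ X ⊗ (X ⊗ X))
    (h : X ⊗ (X ⊗ X) ⟶ X ⊗ X) :
    revComp f (revTensor (snd _ _ ≫ lift (𝟙 X) (𝟙 X)) (snd X X)) (snd _ _ ≫ lift (𝟙 X) (𝟙 X)) =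
      revComp g (snd _ _ ≫ (α_ X X X).inv)
        (revComp h (revTensor (snd X X) (snd _ _ ≫ lift (𝟙 X) (𝟙 X)))
          (snd _ _ ≫ lift (𝟙 X) (𝟙 X))) :=
  hom_ext_lift fun a b => by simp

theorem revComp_add_zero (f : X ⊗ 𝟙_ C ⟶ X ⊗ X) (r : 𝟙_ C ⊗ X ⟶ 𝟙_ C) :
    revComp f (revTensor (snd X X) r) (snd _ _ ≫ lift (𝟙 X) (𝟙 X)) =
      snd _ _ ≫ (ρ_ X).inv :=
  hom_ext_lift fun a b => by ext; simp

theorem revComp_add_tensor (f : (X ⊗ Y) ⊗ (X ⊗ Y) ⟶ (X ⊗ X) ⊗ (Y ⊗ Y)) :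
    snd ((X ⊗ Y) ⊗ (X ⊗ Y)) _ ≫ lift (𝟙 (X ⊗ Y)) (𝟙 (X ⊗ Y)) =
      revComp f (snd _ _ ≫ tensorμ X X Y Y)
        (revTensor (snd _ _ ≫ lift (𝟙 X) (𝟙 X)) (snd _ _ ≫ lift (𝟙 Y) (𝟙 Y))) :=
  hom_ext_lift fun a b => by ext <;> simp

/-! ### Additivity of change, and the laws of copying and discarding -/

variable [CartesianLeftAdditive C]

/-- Additivity of `r : X ⊗ Y ⟶ X` in its second argument. -/
structure IsAdditive {X Y Z : C} (r : X ⊗ Y ⟶ Z) : Prop where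
  add {T : C} (a : T ⟶ X) (b c : T ⟶ Y) : lift a (b + c) ≫ r = lift a b ≫ r + lift a c ≫ r
  zero {T : C} (a : T ⟶ X) : lift a 0 ≫ r = 0

theorem IsAdditive.revComp {X Y Z : C} (f : X ⟶ Y) {rf : X ⊗ Y ⟶ X} {rg : Y ⊗ Z ⟶ Y}
    (hf : IsAdditive rf) (hg : IsAdditive rg) : IsAdditive (revComp f rf rg) :=
  ⟨fun a b c => by simp [hg.add, hf.add], fun a => by simp [hg.zero, hf.zero]⟩

theorem IsAdditive.revTensor {X Y X' Y' : C} {rf : X ⊗ Y ⟶ X} {rg : X' ⊗ Y' ⟶ X'}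
    (hf : IsAdditive rf) (hg : IsAdditive rg) : IsAdditive (revTensor rf rg) :=
  ⟨fun a b c => by simp [hf.add, hg.add, lift_add_lift],
    fun a => by simp [hf.zero, hg.zero, lift_zero_zero]⟩

theorem isAdditive_of_unit {Y : C} (r : 𝟙_ C ⊗ Y ⟶ 𝟙_ C) : IsAdditive r :=
  ⟨fun _ _ _ => toUnit_unique _ _, fun _ => toUnit_unique _ _⟩

theorem isAdditive_zeroHom {X Y : C} : IsAdditive (zeroHom (X ⊗ Y) X) :=
  ⟨fun a b c => by simp [zeroHom_eq], fun a => by simp [zeroHom_eq]⟩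

theorem isAdditive_snd {X Y : C} : IsAdditive (snd X Y) :=
  ⟨fun a b c => by simp, fun a => by simp⟩

theorem isAdditive_snd_comp_add {X Y : C} :
    IsAdditive (snd X (Y ⊗ Y) ≫ CartesianLeftAdditive.add Y) :=
  ⟨fun a b c => by simp [comp_add_eq, add_add_add_comm], fun a => by simp [comp_add_eq]⟩

theorem isAdditive_snd_comp_copy {X Y : C} :
    IsAdditive (snd X Y ≫ lift (𝟙 Y) (𝟙 Y)) :=
  ⟨fun a b c => by simp [lift_add_lift], fun a => by simp [lift_zero_zero]⟩

theorem isAdditive_snd_comp_braiding {X Y Z : C} :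
    IsAdditive (snd X (Y ⊗ Z) ≫ (β_ Y Z).hom) :=
  ⟨fun a b c => by ext <;> simp, fun a => by ext <;> simp⟩

theorem revComp_copy_comm (f : X ⟶ X ⊗ X) :
    revComp f (snd _ _ ≫ CartesianLeftAdditive.add X) (snd _ _ ≫ (β_ X X).hom) =
      snd _ _ ≫ CartesianLeftAdditive.add X :=
  hom_ext_lift fun a b => by simp [CartesianLeftAdditive.add_comm]

theorem revComp_copy_assoc (f : X ⟶ (X ⊗ X) ⊗ X) (g : X ⟶ X ⊗ X) :
    revComp f (revComp g (snd _ _ ≫ CartesianLeftAdditive.add X)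
        (revTensor (snd _ _ ≫ CartesianLeftAdditive.add X) (snd X X)))
        (snd _ _ ≫ (α_ X X X).inv) =
      revComp g (snd _ _ ≫ CartesianLeftAdditive.add X)
        (revTensor (snd X X) (snd _ _ ≫ CartesianLeftAdditive.add X)) :=
  hom_ext_lift fun a b => by simp [comp_add_eq, add_assoc]

theorem revComp_copy_counit (f : X ⟶ X ⊗ 𝟙_ C) (g : X ⟶ X ⊗ X) :
    revComp f (revComp g (snd _ _ ≫ CartesianLeftAdditive.add X)
        (revTensor (snd X X) (zeroHom (X ⊗ 𝟙_ C) X))) (snd _ _ ≫ (ρ_ X).inv) = snd X X :=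
  hom_ext_lift fun a b => by simp [zeroHom_eq]

/-- One side adds the two changes before pulling them back along `f`, the other side after.
Additivity is exactly what is needed; its zero part serves for discarding in the same way. -/
theorem revComp_copy_natural (f : X ⟶ Y) {rf : X ⊗ Y ⟶ X} (hf : IsAdditive rf) :
    revComp f rf (snd _ _ ≫ CartesianLeftAdditive.add Y) =
      revComp (lift (𝟙 X) (𝟙 X)) (snd _ _ ≫ CartesianLeftAdditive.add X) (revTensor rf rf) :=
  hom_ext_lift fun a b => by simp [comp_add_eq, hf.add]

theorem revComp_discard_natural (f : X ⟶ Y) {rf : X ⊗ Y ⟶ X} (hf : IsAdditive rf) :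
    revComp f rf (zeroHom (Y ⊗ 𝟙_ C) Y) = zeroHom (X ⊗ 𝟙_ C) X :=
  hom_ext_lift fun a b => by simp [zeroHom_eq, hf.zero]

theorem revComp_copy_tensor (f : X ⊗ Y ⟶ (X ⊗ X) ⊗ (Y ⊗ Y)) :
    snd (X ⊗ Y) _ ≫ CartesianLeftAdditive.add (X ⊗ Y) =
      revComp f (revTensor (snd _ _ ≫ CartesianLeftAdditive.add X)
        (snd _ _ ≫ CartesianLeftAdditive.add Y)) (snd _ _ ≫ tensorμ X Y X Y) :=
  hom_ext_lift fun a b => by ext <;> simp [comp_add_eq]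

end LeftAdditive

/-! ### Laws of multiplication, differentiated by the product rule -/

section Distributive

variable {C : Type u} [Category.{v} C] [CartesianMonoidalCategory C] [SymmetricCategory C]
  [CartesianDistributive C] {X Y : C}

@[simp]
theorem lift_comp_mulRev {T : C} (a : T ⟶ X ⊗ X) (d : T ⟶ X) :
    lift a d ≫ mulRev X = lift ((a ≫ snd _ _) * d) ((a ≫ fst _ _) * d) := by
  simp [mulRev_eq]

theorem isAdditive_mulRev (X : C) : IsAdditive (mulRev X) :=
  ⟨fun a b c => by simp [mul_add, lift_add_lift], fun a => by simp [lift_zero_zero]⟩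

theorem revComp_mul_comm (X : C) :
    revComp (β_ X X).hom (snd _ _ ≫ (β_ X X).hom) (mulRev X) = mulRev X :=
  hom_ext_lift fun a b => by ext <;> simp

theorem revComp_mul_assoc (X : C) :
    revComp (CartesianDistributive.mul X ⊗ₘ 𝟙 X) (revTensor (mulRev X) (snd X X)) (mulRev X) =
      revComp (α_ X X X).hom (snd _ _ ≫ (α_ X X X).inv)
        (revComp (𝟙 X ⊗ₘ CartesianDistributive.mul X) (revTensor (snd X X) (mulRev X))
          (mulRev X)) :=
  hom_ext_lift fun a b => by ext <;> simp [comp_mul_eq] <;> ring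

theorem revComp_mul_one (X : C) (r : 𝟙_ C ⊗ X ⟶ 𝟙_ C) :
    revComp (𝟙 X ⊗ₘ CartesianDistributive.one X) (revTensor (snd X X) r) (mulRev X) =
      snd _ _ ≫ (ρ_ X).inv :=
  hom_ext_lift fun a b => by ext; simp [comp_one_eq]

/-- Componentwise multiplication on products is not part of `CartesianDistributive`, hence the
hypothesis. In `Circ E` it is one of the defining relations. -/
theorem revComp_mul_tensor
    (h : CartesianDistributive.mul (X ⊗ Y) = tensorμ X Y X Y ≫
      (CartesianDistributive.mul X ⊗ₘ CartesianDistributive.mul Y)) :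
    mulRev (X ⊗ Y) = revComp (tensorμ X Y X Y) (snd _ _ ≫ tensorμ X X Y Y)
      (revTensor (mulRev X) (mulRev Y)) :=
  hom_ext_lift fun a b => by
    have h' {T : C} (f g : T ⟶ X ⊗ Y) : f * g =
        lift ((f ≫ fst _ _) * (g ≫ fst _ _)) ((f ≫ snd _ _) * (g ≫ snd _ _)) := by
      rw [mul_def, h]; ext <;> simp [comp_mul_eq]
    ext <;> simp [h']

theorem revComp_distrib (X : C) :
    revComp (CartesianLeftAdditive.add X ⊗ₘ 𝟙 X)
        (revTensor (snd _ _ ≫ lift (𝟙 X) (𝟙 X)) (snd X X)) (mulRev X) =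
      revComp (𝟙 (X ⊗ X) ⊗ₘ lift (𝟙 X) (𝟙 X))
        (revTensor (snd _ _) (snd _ _ ≫ CartesianLeftAdditive.add X))
        (revComp (tensorμ X X X X) (snd _ _ ≫ tensorμ X X X X)
          (revComp (CartesianDistributive.mul X ⊗ₘ CartesianDistributive.mul X)
            (revTensor (mulRev X) (mulRev X)) (snd _ _ ≫ lift (𝟙 X) (𝟙 X)))) :=
  hom_ext_lift fun a b => by ext <;> simp [comp_add_eq, add_mul]

theorem revComp_mul_zero (X : C) (r : 𝟙_ C ⊗ X ⟶ 𝟙_ C) :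
    revComp (𝟙 X ⊗ₘ CartesianLeftAdditive.zero X) (revTensor (snd X X) r) (mulRev X) =
      revComp (toUnit _) (zeroHom _ _) r :=
  hom_ext_lift fun a b => by ext; simp [comp_zero_eq, zeroHom_eq]

end Distributive

end ReverseDerivative

/-! ### Reverse differentiation of circuits -/

namespace Circ

open ReverseDerivative

variable {Γ : ℕ → ℕ → Type u} {E : CircEquations Γ}

/-- The type of reverse derivatives of morphisms `m → n`. -/
abbrev Rev (E : CircEquations Γ) (m n : ℕ) : Type u :=
  (⟨m⟩ : Circ E) ⊗ (⟨n⟩ : Circ E) ⟶ (⟨m⟩ : Circ E)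

/-- The reverse derivative of a term, given those of the generators. -/
def rev (E : CircEquations Γ) (ρ : ∀ {m n : ℕ}, Γ m n → Rev E m n) :
    ∀ {m n : ℕ}, CircTerm Γ m n → Rev E m n
  | _, _, .gen g => ρ g
  | _, _, .id _ => snd _ _
  | _, _, .comp f g => revComp (ofTerm E f) (rev E ρ f) (rev E ρ g)
  | _, _, .tensor f g => revTensor (rev E ρ f) (rev E ρ g)
  | _, _, .twist m n => snd _ _ ≫ (β_ (⟨n⟩ : Circ E) ⟨m⟩).hom
  | _, _, .copy n => snd _ _ ≫ CartesianLeftAdditive.add (⟨n⟩ : Circ E)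
  | _, _, .discard _ => zeroHom _ _
  | _, _, .add n => snd _ _ ≫ lift (𝟙 (⟨n⟩ : Circ E)) (𝟙 (⟨n⟩ : Circ E))
  | _, _, .zero _ => toUnit _
  | _, _, .mul n => mulRev (⟨n⟩ : Circ E)
  | _, _, .one _ => toUnit _

variable {ρ : ∀ {m n : ℕ}, Γ m n → Rev E m n}

/-- Stated for terms rather than morphisms because it is an ingredient in showing that `rev`
descends to morphisms. -/
theorem rev_isAdditive (hρ : ∀ {m n : ℕ} (g : Γ m n), IsAdditive (ρ g)) {m n : ℕ}
    (t : CircTerm Γ m n) : IsAdditive (rev E ρ t) := by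
  induction t with
  | gen g => exact hρ g
  | id n => exact isAdditive_snd
  | comp f g hf hg => exact hf.revComp _ hg
  | tensor f g hf hg => exact hf.revTensor hg
  | twist m n => exact isAdditive_snd_comp_braiding
  | copy n => exact isAdditive_snd_comp_add
  | discard n => exact isAdditive_zeroHom
  | add n => exact isAdditive_snd_comp_copy
  | zero n => exact isAdditive_of_unit _
  | mul n => exact isAdditive_mulRev _
  | one n => exact isAdditive_of_unit _

theorem rev_castId {m n : ℕ} (h : m = n) :
    rev E ρ (CircTerm.castId h) = snd (⟨m⟩ : Circ E) ⟨n⟩ ≫ castHom E h.symm := by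
  subst h; exact (Category.comp_id _).symm

/-- The interchange is linear and its reverse derivative is the inverse interchange applied to the
change, whence the swapped `b` and `c`. -/
theorem rev_interchange (a b c d : ℕ) :
    rev E ρ (CircTerm.interchange a b c d) =
      snd _ _ ≫ tensorμ (⟨a⟩ : Circ E) ⟨c⟩ ⟨b⟩ ⟨d⟩ := by
  rw [← ofTerm_interchange]
  simp only [CircTerm.interchange, rev, rev_castId]
  exact revComp_revTensor_linear (X := (⟨a + b + (c + d)⟩ : Circ E))
    (Y := (⟨b⟩ : Circ E) ⊗ (⟨c⟩ : Circ E)) (Y' := (⟨c⟩ : Circ E) ⊗ (⟨b⟩ : Circ E))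
    (A := (⟨a⟩ : Circ E)) (D := (⟨d⟩ : Circ E)) _ _ _ _ _

/-- Well-definedness of reverse differentiation. Each relation was verified above in an arbitrary
cartesian category with the relevant structure; what remains is to match the strict presentation
with those forms. -/
theorem rev_congr (hρ : ∀ {m n : ℕ} (g : Γ m n), IsAdditive (ρ g))
    (hE : ∀ {m n : ℕ} {f g : CircTerm Γ m n}, E f g → m = 0)
    {m n : ℕ} {f g : CircTerm Γ m n} (h : CircRel E f g) : rev E ρ f = rev E ρ g := by
  induction h with
  -- With no inputs, both derivatives are maps into the terminal object `0`.
  | ofEq h => obtain rfl := hE h; exact toUnit_unique _ _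
  | refl => rfl
  | symm _ ih => exact ih.symm
  | trans _ _ ih ih' => exact ih.trans ih'
  -- The chain rule also involves the morphism `f` as base point, so the relation itself is needed
  -- besides the induction hypotheses.
  | comp_congr h _ ih ih' =>
    simp only [rev, ih, ih']; rw [show ofTerm E _ = ofTerm E _ from Quotient.sound h]
  | tensor_congr _ _ ih ih' => simp only [rev, ih, ih']
  | id_comp f => exact revComp_id_left (rev E ρ f)
  | comp_id f => exact revComp_id_right (ofTerm E f) (rev E ρ f)
  | comp_assoc f g h => exact revComp_assoc (ofTerm E f) (ofTerm E g) (rev E ρ f) (rev E ρ g) (rev E ρ h)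
  | id_tensor_id m n => exact revTensor_id (⟨m⟩ : Circ E) ⟨n⟩
  | tensor_comp_tensor f g f' g' => 
    exact revComp_revTensor (ofTerm E f) (ofTerm E f') (rev E ρ f) (rev E ρ f') (rev E ρ g) (rev E ρ g')
  | tensor_assoc f g h =>
    simp only [rev, rev_castId]
    exact revTensor_assoc (ofTerm E f) (ofTerm E g) (ofTerm E h) (rev E ρ f) (rev E ρ g) (rev E ρ h)
  | unit_tensor f =>
    simp only [rev, rev_castId]
    exact revTensor_unit_left (ofTerm E f) (rev E ρ f)
  | tensor_unit f =>
    simp only [rev, rev_castId]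
    exact revTensor_unit_right (ofTerm E f) (rev E ρ f)
  | twist_twist m n => exact revComp_braiding_braiding (⟨m⟩ : Circ E) ⟨n⟩
  | twist_natural f g => exact revComp_braiding_natural (ofTerm E f) (ofTerm E g) (rev E ρ f) (rev E ρ g)
  | hexagon a b c =>
    simp only [rev, rev_castId]
    exact revComp_hexagon (⟨a⟩ : Circ E) ⟨b⟩ ⟨c⟩
  | copy_comm n => exact revComp_copy_comm (X := (⟨n⟩ : Circ E)) _
  | copy_assoc n =>
    simp only [rev, rev_castId]
    exact revComp_copy_assoc (X := (⟨n⟩ : Circ E)) _ _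
  | copy_counit n =>
    simp only [rev, rev_castId]
    exact revComp_copy_counit (X := (⟨n⟩ : Circ E)) _ _
  | @copy_natural m n f =>
    -- The categorical diagonal equals the copy generator only up to `lift_id_id`, so the general
    -- lemma is rewritten before use.
    have h := revComp_copy_natural (ofTerm E f) (rev_isAdditive hρ f)
    rw [lift_id_id] at h
    exact h
  | discard_natural f => exact revComp_discard_natural (ofTerm E f) (rev_isAdditive hρ f)
  | copy_tensor m n =>
    simp only [rev, rev_interchange]
    exact revComp_copy_tensor (X := (⟨m⟩ : Circ E)) (Y := ⟨n⟩) _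
  | discard_unit => exact toUnit_unique _ _
  | add_comm n => exact revComp_add_comm (X := (⟨n⟩ : Circ E)) _
  | add_assoc n =>
    simp only [rev, rev_castId]
    exact revComp_add_assoc (X := (⟨n⟩ : Circ E)) _ _ _
  | add_zero n =>
    simp only [rev, rev_castId]
    exact revComp_add_zero (X := (⟨n⟩ : Circ E)) _ _
  | add_tensor m n =>
    simp only [rev, rev_interchange]
    exact revComp_add_tensor (X := (⟨m⟩ : Circ E)) (Y := ⟨n⟩) _
  | zero_tensor m n => exact toUnit_unique _ _
  | mul_comm n => exact revComp_mul_comm (⟨n⟩ : Circ E)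
  | mul_assoc n =>
    simp only [rev, rev_castId]
    exact revComp_mul_assoc (⟨n⟩ : Circ E)
  | mul_one n =>
    simp only [rev, rev_castId]
    exact revComp_mul_one (⟨n⟩ : Circ E) _
  | mul_tensor m n =>
    simp only [rev, rev_interchange, ofTerm_interchange]
    exact revComp_mul_tensor (X := (⟨m⟩ : Circ E)) (Y := ⟨n⟩)
      (by rw [← ofTerm_interchange]; exact Quotient.sound (.mul_tensor m n))
  | one_tensor m n => exact toUnit_unique _ _
  | distrib n =>
    have h := revComp_distrib (⟨n⟩ : Circ E)
    rw [lift_id_id] at h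
    simp only [rev, rev_interchange, ofTerm_interchange]
    rw [lift_id_id]
    exact h
  | mul_zero n => exact revComp_mul_zero (⟨n⟩ : Circ E) _

end Circ

/-! ### Forward derivatives -/

namespace ReverseDerivative

section LeftAdditive

variable {C : Type u} [Category.{v} C] [CartesianMonoidalCategory C] [SymmetricCategory C]
  [CartesianLeftAdditive C]

/-- An operator satisfying the structural axioms of a reverse differential combinator and
additivity of change. -/
structure AdditiveReverseCombinator (C : Type u) [Category.{v} C] [CartesianMonoidalCategory C]
    [SymmetricCategory C] [CartesianLeftAdditive C] where
  /-- The operator. -/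
  R : Operator C
  R_id (A : C) : R (𝟙 A) = snd A A
  R_rightUnitor (A : C) : R (ρ_ A).hom = snd _ _ ≫ (ρ_ A).inv
  R_copy (A : C) : R (lift (𝟙 A) (𝟙 A)) = snd A (A ⊗ A) ≫ CartesianLeftAdditive.add A
  R_add (A : C) : R (CartesianLeftAdditive.add A) = snd (A ⊗ A) A ≫ lift (𝟙 A) (𝟙 A)
  R_twist (A B : C) : R (β_ A B).hom = snd (A ⊗ B) (B ⊗ A) ≫ (β_ B A).hom
  R_discard (A : C) : R (toUnit A) = zeroHom (A ⊗ 𝟙_ C) A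
  R_comp {A B X : C} (f : A ⟶ B) (g : B ⟶ X) : R (f ≫ g) = revComp f (R f) (R g)
  R_tensor {A B A' B' : C} (f : A ⟶ B) (g : A' ⟶ B') : R (f ⊗ₘ g) = revTensor (R f) (R g)
  R_additive {A B : C} (f : A ⟶ B) : IsAdditive (R f)

namespace AdditiveReverseCombinator

variable (P : AdditiveReverseCombinator C) {T X Y Z W : C}

theorem lift_comp_R_comp (a : T ⟶ X) (d : T ⟶ Z) (f : X ⟶ Y) (g : Y ⟶ Z) :
    lift a d ≫ P.R (f ≫ g) = lift a (lift (a ≫ f) d ≫ P.R g) ≫ P.R f := by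
  rw [P.R_comp, lift_comp_revComp]

theorem R_comp_eq_lift (f : X ⟶ Y) (g : Y ⟶ Z) :
    P.R (f ≫ g) = lift (fst _ _) (lift (fst _ _ ≫ f) (snd _ _) ≫ P.R g) ≫ P.R f :=
  hom_ext_lift fun a b => by rw [lift_comp_R_comp]; simp [comp_lift_assoc]

/-- A pairing is a copy followed by a tensor, and the reverse derivative of copying adds the two
contributions. -/
theorem lift_comp_R_lift (a : T ⟶ X) (d : T ⟶ Y ⊗ Z) (f : X ⟶ Y) (g : X ⟶ Z) :
    lift a d ≫ P.R (lift f g) =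
      lift a (d ≫ fst _ _) ≫ P.R f + lift a (d ≫ snd _ _) ≫ P.R g := by
  have h : lift f g = lift (𝟙 X) (𝟙 X) ≫ (f ⊗ₘ g) := by simp
  rw [h, lift_comp_R_comp, P.R_copy, P.R_tensor]
  simp [comp_add_eq]

theorem lift_comp_R_zero (a : T ⟶ X) (d : T ⟶ Y) : lift a d ≫ P.R (0 : X ⟶ Y) = 0 := by
  rw [← zeroHom_eq, zeroHom, lift_comp_R_comp, P.R_discard]
  simp [zeroHom_eq]

theorem lift_comp_R_toUnit (a : T ⟶ X) (d : T ⟶ 𝟙_ C) : lift a d ≫ P.R (toUnit X) = 0 := by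
  simp [P.R_discard, zeroHom_eq]

theorem lift_comp_R_id (a : T ⟶ X) (d : T ⟶ X) : lift a d ≫ P.R (𝟙 X) = d := by
  simp [P.R_id]

/-- The projection discards one factor and then removes a unit, which is why `R_rightUnitor` is
among the axioms assumed. -/
theorem lift_comp_R_fst (a : T ⟶ X ⊗ Y) (d : T ⟶ X) : lift a d ≫ P.R (fst X Y) = lift d 0 := by
  have h : fst X Y = (𝟙 X ⊗ₘ toUnit Y) ≫ (ρ_ X).hom := by simp [rightUnitor_hom]
  rw [h, lift_comp_R_comp, P.R_tensor, P.R_rightUnitor]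
  ext <;> simp [lift_comp_R_toUnit, lift_comp_R_id]

theorem lift_comp_R_snd (a : T ⟶ X ⊗ Y) (d : T ⟶ Y) : lift a d ≫ P.R (snd X Y) = lift 0 d := by
  rw [← braiding_hom_fst, lift_comp_R_comp, lift_comp_R_fst, P.R_twist]
  ext <;> simp

theorem lift_comp_R_hom_add (a : T ⟶ X) (d : T ⟶ Y) (f g : X ⟶ Y) :
    lift a d ≫ P.R (f + g) = lift a d ≫ P.R f + lift a d ≫ P.R g := by
  rw [add_def, lift_comp_R_comp, P.R_add, lift_comp_R_lift]
  simp

theorem lift_comp_fwd (x v : T ⟶ X) (f : X ⟶ Y) :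
    lift x v ≫ fwd P.R f = (lift (lift x 0) v ≫ P.R (P.R f)) ≫ snd X Y := by
  simp [fwd, comp_lift_assoc, zeroHom_eq]

/-- The forward chain rule, from differentiating `R[f](a, R[g](f a, c))` in reverse at `c = 0` and
keeping the `c` component. Additivity gives `R[g](f a, 0) = 0`, so the outer derivative is taken at
`(x, 0)` and yields `D[f](x, v)`. This is then fed to `R[R[g]]` at `(f x, 0)`, which is `D[g]`. -/
theorem lift_comp_fwd_comp (x v : T ⟶ X) (f : X ⟶ Y) (g : Y ⟶ Z) :
    lift x v ≫ fwd P.R (f ≫ g) = lift (x ≫ f) (lift x v ≫ fwd P.R f) ≫ fwd P.R g := by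
  rw [lift_comp_fwd, lift_comp_fwd, lift_comp_fwd, P.R_comp_eq_lift]
  simp only [lift_comp_R_comp, lift_comp_R_lift, lift_comp_R_fst, lift_comp_R_snd, comp_lift,
    lift_fst, lift_snd, lift_fst_assoc, comp_lift_assoc, (P.R_additive _).zero,
    hom_add_snd, zero_add]

theorem lift_comp_fwd_lift (x v : T ⟶ X) (f : X ⟶ Y) (g : X ⟶ Z) :
    lift x v ≫ fwd P.R (lift f g) = lift (lift x v ≫ fwd P.R f) (lift x v ≫ fwd P.R g) := by
  have h : P.R (lift f g) = lift (fst _ _) (snd _ _ ≫ fst _ _) ≫ P.R f +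
      lift (fst _ _) (snd _ _ ≫ snd _ _) ≫ P.R g :=
    hom_ext_lift fun a b => by rw [lift_comp_R_lift]; simp [comp_lift_assoc]
  rw [lift_comp_fwd, lift_comp_fwd, lift_comp_fwd, h]
  simp only [lift_comp_R_hom_add, lift_comp_R_comp, lift_comp_R_lift, lift_comp_R_fst,
    lift_comp_R_snd, comp_lift, lift_fst, lift_snd, lift_snd_assoc, zero_add, hom_zero_fst, hom_zero_snd, lift_add_lift, add_zero]

theorem lift_comp_fwd_zero (x v : T ⟶ X) : lift x v ≫ fwd P.R (0 : X ⟶ Y) = 0 := by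
  have h : P.R (0 : X ⟶ Y) = 0 :=
    hom_ext_lift fun a b => by rw [lift_comp_R_zero]; simp
  rw [lift_comp_fwd, h, lift_comp_R_zero, hom_zero_snd]

theorem lift_comp_fwd_id (x v : T ⟶ X) : lift x v ≫ fwd P.R (𝟙 X) = v := by
  rw [lift_comp_fwd, P.R_id, lift_comp_R_snd, lift_snd]

theorem lift_comp_fwd_fst (x v : T ⟶ X ⊗ Y) : lift x v ≫ fwd P.R (fst X Y) = v ≫ fst _ _ := by
  have h : P.R (fst X Y) = lift (snd _ _) 0 :=
    hom_ext_lift fun a b => by rw [lift_comp_R_fst]; simp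
  rw [lift_comp_fwd, h, lift_comp_R_lift, lift_comp_R_snd, lift_comp_R_zero]
  simp

theorem lift_comp_fwd_snd (x v : T ⟶ X ⊗ Y) : lift x v ≫ fwd P.R (snd X Y) = v ≫ snd _ _ := by
  have h : P.R (snd X Y) = lift 0 (snd _ _) :=
    hom_ext_lift fun a b => by rw [lift_comp_R_snd]; simp
  rw [lift_comp_fwd, h, lift_comp_R_lift, lift_comp_R_snd, lift_comp_R_zero]
  simp

theorem lift_comp_fwd_add (x v : T ⟶ X ⊗ X) :
    lift x v ≫ fwd P.R (CartesianLeftAdditive.add X) = v ≫ fst _ _ + v ≫ snd _ _ := by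
  rw [lift_comp_fwd, P.R_add, lift_comp_R_comp, lift_comp_R_lift, lift_comp_R_snd]
  simp [lift_comp_R_id]

theorem lift_comp_fwd_hom_add (x v : T ⟶ X) (f g : X ⟶ Y) :
    lift x v ≫ fwd P.R (f + g) = lift x v ≫ fwd P.R f + lift x v ≫ fwd P.R g := by
  rw [add_def, lift_comp_fwd_comp, lift_comp_fwd_add, lift_comp_fwd_lift, lift_fst, lift_snd]

/-- The forward derivative vanishes in the direction zero. -/
theorem lift_zero_comp_fwd (x : T ⟶ X) (f : X ⟶ Y) : lift x 0 ≫ fwd P.R f = 0 := by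
  rw [lift_comp_fwd, (P.R_additive _).zero, hom_zero_snd]

end AdditiveReverseCombinator

end LeftAdditive

namespace AdditiveReverseCombinator

variable {C : Type u} [Category.{v} C] [CartesianMonoidalCategory C] [SymmetricCategory C]
  [CartesianDistributive C] (P : AdditiveReverseCombinator C) {T X Y Z W : C}

theorem lift_comp_R_hom_mul (h : P.R (CartesianDistributive.mul Y) = mulRev Y)
    (a : T ⟶ X) (d : T ⟶ Y) (f g : X ⟶ Y) :
    lift a d ≫ P.R (f * g) =
      lift a ((a ≫ g) * d) ≫ P.R f + lift a ((a ≫ f) * d) ≫ P.R g := by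
  rw [mul_def, lift_comp_R_comp, h, lift_comp_R_lift]
  simp

theorem lift_comp_fwd_mul (h : P.R (CartesianDistributive.mul X) = mulRev X)
    (x v : T ⟶ X ⊗ X) :
    lift x v ≫ fwd P.R (CartesianDistributive.mul X) =
      (x ≫ fst _ _) * (v ≫ snd _ _) + (x ≫ snd _ _) * (v ≫ fst _ _) := by
  rw [lift_comp_fwd, h, mulRev_eq]
  simp only [lift_comp_R_lift, P.lift_comp_R_hom_mul h, lift_comp_R_comp, lift_comp_R_snd,
    lift_comp_R_fst]
  simp [add_comm]

theorem lift_comp_fwd_hom_mul (h : P.R (CartesianDistributive.mul Y) = mulRev Y)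
    (x v : T ⟶ X) (f g : X ⟶ Y) :
    lift x v ≫ fwd P.R (f * g) =
      (x ≫ f) * (lift x v ≫ fwd P.R g) + (x ≫ g) * (lift x v ≫ fwd P.R f) := by
  rw [mul_def, lift_comp_fwd_comp, P.lift_comp_fwd_mul h, lift_comp_fwd_lift]
  simp

end AdditiveReverseCombinator

end ReverseDerivative

/-! ### Linearity of change and symmetry of partial derivatives -/

namespace ReverseDerivative.AdditiveReverseCombinator

section LeftAdditive

variable {C : Type u} [Category.{v} C] [CartesianMonoidalCategory C] [SymmetricCategory C]
  [CartesianLeftAdditive C] (P : AdditiveReverseCombinator C) {X Y Z W : C}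

/-- Linearity of change for `f`. -/
structure IsLinear (f : X ⟶ Y) : Prop where
  eq {T : C} (a : T ⟶ X) (b w : T ⟶ Y) :
    lift (lift a b) (lift 0 w) ≫ fwd P.R (P.R f) = lift a w ≫ P.R f

/-- Symmetry of the second partial derivatives of `f`. -/
structure IsSymm (f : X ⟶ Y) : Prop where
  eq {T : C} (x v w z : T ⟶ X) :
    lift (lift x v) (lift w z) ≫ fwd P.R (fwd P.R f) =
      lift (lift x w) (lift v z) ≫ fwd P.R (fwd P.R f)

variable {P}

theorem IsLinear.fwdSnd_eq {f : X ⟶ Y} (hf : P.IsLinear f) :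
    fwdSnd P.R (P.R f) = dropMid (P.R f) := by
  have h := hf.eq (fst X (Y ⊗ Y)) (snd _ _ ≫ fst _ _) (snd _ _ ≫ snd _ _)
  rw [fwdSnd, zeroHom_eq, h, dropMid]
  congr 1
  ext <;> simp

theorem IsSymm.fwd_fwd_eq {f : X ⟶ Y} (hf : P.IsSymm f) :
    fwd P.R (fwd P.R f) = tensorμ X X X X ≫ fwd P.R (fwd P.R f) := by
  have h := hf.eq (fst _ _ ≫ fst X X) (fst _ _ ≫ snd X X) (snd _ _ ≫ fst X X) (snd _ _ ≫ snd X X)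
  have h1 : lift (lift (fst (X ⊗ X) (X ⊗ X) ≫ fst X X) (fst _ _ ≫ snd X X))
      (lift (snd _ _ ≫ fst X X) (snd _ _ ≫ snd X X)) = 𝟙 _ := by simp
  have h2 : lift (lift (fst (X ⊗ X) (X ⊗ X) ≫ fst X X) (snd _ _ ≫ fst X X))
      (lift (fst _ _ ≫ snd X X) (snd _ _ ≫ snd X X)) = tensorμ X X X X := by ext <;> simp
  rwa [h1, h2, Category.id_comp] at h

/-- A combinator all of whose values are linear and symmetric. -/
def toCombinator (P : AdditiveReverseCombinator C) (hl : ∀ {A B : C} (f : A ⟶ B), P.IsLinear f)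
    (hs : ∀ {A B : C} (f : A ⟶ B), P.IsSymm f) : ReverseDifferentialCombinator C where
  R := P.R
  R_id := P.R_id
  R_copy := P.R_copy
  R_add := P.R_add
  R_twist := P.R_twist
  R_discard := P.R_discard
  R_zero _ := toUnit_unique _ _
  R_comp := P.R_comp
  R_tensor := P.R_tensor
  R_additive {A B} f := by
    have h := (P.R_additive f).add (fst A (B ⊗ B)) (snd _ _ ≫ fst _ _) (snd _ _ ≫ snd _ _)
    have h1 : A ◁ CartesianLeftAdditive.add B =
        lift (fst A (B ⊗ B)) (snd _ _ ≫ fst B B + snd _ _ ≫ snd B B) := by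
      ext <;> simp [add_eq]
    have h2 : (lift (𝟙 A) (𝟙 A) ▷ (B ⊗ B)) ≫ tensorμ A A B B = lift
        (lift (fst A (B ⊗ B)) (snd _ _ ≫ fst B B)) (lift (fst A (B ⊗ B)) (snd _ _ ≫ snd B B)) := by
      ext <;> simp
    rw [h1, h, reassoc_of% h2, lift_map_assoc]
    rfl
  R_additive_zero {A B} f := by
    have h : A ◁ CartesianLeftAdditive.zero B = lift (fst A (𝟙_ C)) 0 := by
      ext <;> simp [zero_eq]
    rw [h, (P.R_additive f).zero]
    rfl
  R_linear f := (hl f).fwdSnd_eq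
  R_symm f := (hs f).fwd_fwd_eq

/-- Apply the forward chain rule to `R[f](a, R[g](f a, b))` in the direction `(0, w)`. As `D[f](a,
0) = 0`, linearity of `g` turns the inner derivative into `R[g](f a, w)`, again a direction in the
second slot only, where linearity of `f` applies. -/
theorem IsLinear.comp {f : X ⟶ Y} {g : Y ⟶ Z} (hf : P.IsLinear f) (hg : P.IsLinear g) :
    P.IsLinear (f ≫ g) := ⟨fun a b w => by
  simp only [P.R_comp_eq_lift, lift_comp_fwd_comp, lift_comp_fwd_lift, lift_comp_fwd_fst,
    lift_comp_fwd_snd, comp_lift, comp_lift_assoc, lift_fst, lift_snd, lift_fst_assoc,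
    lift_zero_comp_fwd, hg.eq, hf.eq]⟩

theorem IsLinear.tensor {X' Y' : C} {f : X ⟶ Y} {g : X' ⟶ Y'} (hf : P.IsLinear f)
    (hg : P.IsLinear g) : P.IsLinear (f ⊗ₘ g) := ⟨fun a b w => by
  have h : P.R (f ⊗ₘ g) = lift (lift (fst _ _ ≫ fst _ _) (snd _ _ ≫ fst _ _) ≫ P.R f)
      (lift (fst _ _ ≫ snd _ _) (snd _ _ ≫ snd _ _) ≫ P.R g) := by
    rw [P.R_tensor]; exact hom_ext_lift fun a b => by simp
  simp only [h, lift_comp_fwd_comp, lift_comp_fwd_lift, lift_comp_fwd_fst,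
    lift_comp_fwd_snd, comp_lift, comp_lift_assoc, lift_fst, lift_snd, lift_fst_assoc,
    lift_snd_assoc, hom_zero_fst, hom_zero_snd, hg.eq, hf.eq]⟩

/-- The unit in question is the codomain of `P.R f`. -/
theorem isLinear_of_codomain_unit (f : 𝟙_ C ⟶ X) : P.IsLinear f :=
  ⟨fun _ _ _ => toUnit_unique _ _⟩

/-- Linearity of change involves `f` only through `P.R f`. This transfers it from addition to the
comparator. -/
theorem IsLinear.of_R_eq {f g : X ⟶ Y} (h : P.R f = P.R g) (hg : P.IsLinear g) :
    P.IsLinear f := by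
  exact ⟨by rw [h]; exact hg.eq⟩

theorem isLinear_id (X : C) : P.IsLinear (𝟙 X) := ⟨fun a b w => by
  simp [P.R_id, lift_comp_fwd_snd]⟩

theorem isLinear_braiding (X Y : C) : P.IsLinear (β_ X Y).hom := ⟨fun a b w => by
  rw [P.R_twist, ← lift_snd_fst]
  simp [lift_comp_fwd_comp, lift_comp_fwd_lift, lift_comp_fwd_fst, lift_comp_fwd_snd]⟩

theorem isLinear_copy (X : C) : P.IsLinear (lift (𝟙 X) (𝟙 X)) := ⟨fun a b w => by
  rw [P.R_copy, lift_comp_fwd_comp, lift_comp_fwd_add, lift_comp_fwd_snd]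
  simp [comp_add_eq]⟩

theorem isLinear_toUnit (X : C) : P.IsLinear (toUnit X) := ⟨fun a b w => by
  rw [P.R_discard, zeroHom_eq]
  simp [lift_comp_fwd_zero]⟩

theorem isLinear_add (X : C) : P.IsLinear (CartesianLeftAdditive.add X) := ⟨fun a b w => by
  rw [P.R_add]
  simp [lift_comp_fwd_lift, lift_comp_fwd_snd]⟩

/-! ### Forward derivatives as morphisms, and symmetry of second derivatives -/

theorem fwd_comp (f : X ⟶ Y) (g : Y ⟶ Z) :
    fwd P.R (f ≫ g) = lift (fst _ _ ≫ f) (fwd P.R f) ≫ fwd P.R g :=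
  hom_ext_lift fun a b => by rw [lift_comp_fwd_comp]; simp [comp_lift_assoc]

theorem fwd_lift (f : X ⟶ Y) (g : X ⟶ Z) :
    fwd P.R (lift f g) = lift (fwd P.R f) (fwd P.R g) :=
  hom_ext_lift fun a b => by rw [lift_comp_fwd_lift]; simp

theorem fwd_fst (X Y : C) : fwd P.R (fst X Y) = snd _ _ ≫ fst X Y :=
  hom_ext_lift fun a b => by rw [lift_comp_fwd_fst]; simp

theorem fwd_snd (X Y : C) : fwd P.R (snd X Y) = snd _ _ ≫ snd X Y :=
  hom_ext_lift fun a b => by rw [lift_comp_fwd_snd]; simp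

theorem fwd_id (X : C) : fwd P.R (𝟙 X) = snd X X :=
  hom_ext_lift fun a b => by rw [lift_comp_fwd_id]; simp

theorem fwd_add (X : C) : fwd P.R (CartesianLeftAdditive.add X) =
    snd _ _ ≫ fst _ _ + snd _ _ ≫ snd _ _ :=
  hom_ext_lift fun a b => by rw [lift_comp_fwd_add]; simp

/-- By the chain rule, the second derivative of `f ≫ g` is that of `g` at `((f x, D[f](x, v)),
(D[f](x, w), D[D[f]]((x, v), (w, z))))`. Symmetry of `g` exchanges the two middle entries and
symmetry of `f` handles the last. -/
theorem IsSymm.comp {f : X ⟶ Y} {g : Y ⟶ Z} (hf : P.IsSymm f) (hg : P.IsSymm g) :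
    P.IsSymm (f ≫ g) := ⟨fun x v w z => by
  simp only [fwd_comp f g, lift_comp_fwd_comp, lift_comp_fwd_lift, lift_comp_fwd_fst, comp_lift,
    lift_fst, lift_fst_assoc]
  rw [hg.eq, hf.eq]⟩

theorem IsSymm.lift {f : X ⟶ Y} {g : X ⟶ Z} (hf : P.IsSymm f) (hg : P.IsSymm g) :
    P.IsSymm (lift f g) := ⟨fun x v w z => by
  rw [fwd_lift, lift_comp_fwd_lift, lift_comp_fwd_lift, hf.eq, hg.eq]⟩

theorem isSymm_fst (X Y : C) : P.IsSymm (fst X Y) := ⟨fun x v w z => by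
  simp [fwd_fst, lift_comp_fwd_comp, lift_comp_fwd_snd]⟩

theorem isSymm_snd (X Y : C) : P.IsSymm (snd X Y) := ⟨fun x v w z => by
  simp [fwd_snd, lift_comp_fwd_comp]⟩

theorem isSymm_id (X : C) : P.IsSymm (𝟙 X) := ⟨fun x v w z => by
  simp [fwd_id, lift_comp_fwd_snd]⟩

theorem isSymm_toUnit (X : C) : P.IsSymm (toUnit X) := ⟨fun _ _ _ _ => toUnit_unique _ _⟩

/-- The two directions to be exchanged are maps into the terminal object, hence equal. -/
theorem isSymm_of_domain_unit (f : 𝟙_ C ⟶ X) : P.IsSymm f := ⟨fun x v w z => by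
  rw [toUnit_unique v w]⟩

theorem isSymm_add (X : C) : P.IsSymm (CartesianLeftAdditive.add X) := ⟨fun x v w z => by
  simp [fwd_add, lift_comp_fwd_hom_add, lift_comp_fwd_comp, lift_comp_fwd_fst, lift_comp_fwd_snd]⟩

/-- The forward derivative, and hence its own derivative, is computed from `P.R f` alone. -/
theorem IsSymm.of_R_eq {f g : X ⟶ Y} (h : P.R f = P.R g) (hg : P.IsSymm g) : P.IsSymm f := by
  have h' : fwd P.R f = fwd P.R g := by rw [fwd, fwd, h]
  exact ⟨by rw [h']; exact hg.eq⟩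

theorem IsSymm.tensor {X' Y' : C} {f : X ⟶ Y} {g : X' ⟶ Y'} (hf : P.IsSymm f)
    (hg : P.IsSymm g) : P.IsSymm (f ⊗ₘ g) := by
  rw [← lift_fst_comp_snd_comp]
  exact ((isSymm_fst _ _).comp hf).lift ((isSymm_snd _ _).comp hg)

theorem isSymm_braiding (X Y : C) : P.IsSymm (β_ X Y).hom := by
  rw [← lift_snd_fst]
  exact (isSymm_snd _ _).lift (isSymm_fst _ _)

end LeftAdditive

/-! ### Linearity and symmetry for multiplication -/

section Distributive

variable {C : Type u} [Category.{v} C] [CartesianMonoidalCategory C] [SymmetricCategory C]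
  [CartesianDistributive C] {P : AdditiveReverseCombinator C} {X : C}

theorem isLinear_mul (h : P.R (CartesianDistributive.mul X) = mulRev X) :
    P.IsLinear (CartesianDistributive.mul X) := ⟨fun a b w => by
  rw [h, lift_comp_mulRev, mulRev_eq]
  simp [lift_comp_fwd_lift, P.lift_comp_fwd_hom_mul h, lift_comp_fwd_comp, lift_comp_fwd_fst,
    lift_comp_fwd_snd]⟩

theorem isSymm_mul (h : P.R (CartesianDistributive.mul X) = mulRev X) :
    P.IsSymm (CartesianDistributive.mul X) := ⟨fun x v w z => by
  have h' : fwd P.R (CartesianDistributive.mul X) =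
      (fst _ _ ≫ fst _ _) * (snd _ _ ≫ snd _ _) + (fst _ _ ≫ snd _ _) * (snd _ _ ≫ fst _ _) :=
    hom_ext_lift fun a b => by rw [P.lift_comp_fwd_mul h]; simp
  rw [h']
  simp only [lift_comp_fwd_hom_add, P.lift_comp_fwd_hom_mul h, lift_comp_fwd_comp,
    lift_comp_fwd_fst, lift_comp_fwd_snd, lift_fst, lift_snd, lift_fst_assoc, lift_snd_assoc]
  ring⟩

end Distributive

end ReverseDerivative.AdditiveReverseCombinator

/-! ### Reverse differential combinators on circuits -/

namespace Circ

open ReverseDerivative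

variable {Γ : ℕ → ℕ → Type u} {E : CircEquations Γ} {ρ : ∀ {m n : ℕ}, Γ m n → Rev E m n}
  (hρ : ∀ {m n : ℕ} (g : Γ m n), IsAdditive (ρ g))
  (hE : ∀ {m n : ℕ} {f g : CircTerm Γ m n}, E f g → m = 0)

/-- Reverse differentiation of morphisms of circuits, given that of the generators. All equations
are assumed to be between terms without inputs, hence are respected for trivial reasons. -/
def additiveReverseCombinator : AdditiveReverseCombinator (Circ E) where
  R _ _ f := Quotient.lift (rev E ρ) (fun _ _ h => rev_congr hρ hE h) f
  R_id _ := rfl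
  R_rightUnitor A := rev_castId (Nat.add_zero A.len)
  R_copy A := by rw [lift_id_id]; rfl
  R_add _ := rfl
  R_twist _ _ := rfl
  R_discard _ := rfl
  R_comp f g := Quotient.inductionOn₂ f g fun _ _ => rfl
  R_tensor f g := Quotient.inductionOn₂ f g fun _ _ => rfl
  R_additive f := Quotient.inductionOn f fun t => rev_isAdditive hρ t

/-- Structural induction on a representing term: closure under composition and tensor leaves only
the structural and the given generators. -/
theorem isLinear_of_gen
    (h : ∀ {m n : ℕ} (g : Γ m n),
      (additiveReverseCombinator hρ hE).IsLinear (ofTerm E (CircTerm.gen g)))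
    {X Y : Circ E} (f : X ⟶ Y) : (additiveReverseCombinator hρ hE).IsLinear f := by
  suffices ht : ∀ {m n : ℕ} (t : CircTerm Γ m n),
      (additiveReverseCombinator hρ hE).IsLinear (ofTerm E t) from
    Quotient.inductionOn f fun t => ht t
  intro m n t
  induction t with
  | gen g => exact h g
  | id n => exact AdditiveReverseCombinator.isLinear_id _
  | comp f g hf hg => exact hf.comp hg
  | tensor f g hf hg => exact hf.tensor hg
  | twist m n => exact AdditiveReverseCombinator.isLinear_braiding (⟨m⟩ : Circ E) ⟨n⟩
  | copy n =>
    have h := AdditiveReverseCombinator.isLinear_copy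
      (P := additiveReverseCombinator hρ hE) (⟨n⟩ : Circ E)
    rwa [lift_id_id] at h
  | discard n => exact AdditiveReverseCombinator.isLinear_toUnit _
  | add n => exact AdditiveReverseCombinator.isLinear_add (⟨n⟩ : Circ E)
  | zero n => exact AdditiveReverseCombinator.isLinear_of_codomain_unit _
  | mul n => exact AdditiveReverseCombinator.isLinear_mul (X := (⟨n⟩ : Circ E)) rfl
  | one n => exact AdditiveReverseCombinator.isLinear_of_codomain_unit _

theorem isSymm_of_gen
    (h : ∀ {m n : ℕ} (g : Γ m n),
      (additiveReverseCombinator hρ hE).IsSymm (ofTerm E (CircTerm.gen g)))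
    {X Y : Circ E} (f : X ⟶ Y) : (additiveReverseCombinator hρ hE).IsSymm f := by
  suffices ht : ∀ {m n : ℕ} (t : CircTerm Γ m n),
      (additiveReverseCombinator hρ hE).IsSymm (ofTerm E t) from
    Quotient.inductionOn f fun t => ht t
  intro m n t
  induction t with
  | gen g => exact h g
  | id n => exact AdditiveReverseCombinator.isSymm_id _
  | comp f g hf hg => exact hf.comp hg
  | tensor f g hf hg => exact hf.tensor hg
  | twist m n => exact AdditiveReverseCombinator.isSymm_braiding (⟨m⟩ : Circ E) ⟨n⟩
  | copy n =>
    have h := (AdditiveReverseCombinator.isSymm_id (P := additiveReverseCombinator hρ hE)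
      (⟨n⟩ : Circ E)).lift (AdditiveReverseCombinator.isSymm_id _)
    rwa [lift_id_id] at h
  | discard n => exact AdditiveReverseCombinator.isSymm_toUnit _
  | add n => exact AdditiveReverseCombinator.isSymm_add (⟨n⟩ : Circ E)
  | zero n => exact AdditiveReverseCombinator.isSymm_of_domain_unit _
  | mul n => exact AdditiveReverseCombinator.isSymm_mul (X := (⟨n⟩ : Circ E)) rfl
  | one n => exact AdditiveReverseCombinator.isSymm_of_domain_unit _

/-! Renaming of generators is compatible with reverse differentiation. -/

section Map

variable {Γ' : ℕ → ℕ → Type u} {E' : CircEquations Γ'} (φ : ∀ ⦃m n : ℕ⦄, Γ m n → Γ' m n)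
  (hφ : ∀ {m n : ℕ} (f g : CircTerm Γ m n), E f g →
    CircRel E' (CircTerm.map φ f) (CircTerm.map φ g))

theorem mapHom_comp {X Y Z : Circ E} (f : X ⟶ Y) (g : Y ⟶ Z) :
    mapHom φ hφ (f ≫ g) = mapHom φ hφ f ≫ mapHom φ hφ g :=
  Quotient.inductionOn₂ f g fun _ _ => rfl

theorem mapHom_tensorHom {X Y X' Y' : Circ E} (f : X ⟶ Y) (g : X' ⟶ Y') :
    mapHom φ hφ (f ⊗ₘ g) =
      ((mapHom φ hφ f : (⟨X.len⟩ : Circ E') ⟶ ⟨Y.len⟩) ⊗ₘ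
        (mapHom φ hφ g : (⟨X'.len⟩ : Circ E') ⟶ ⟨Y'.len⟩)) :=
  Quotient.inductionOn₂ f g fun _ _ => rfl

theorem mapHom_lift {X Y Z : Circ E} (f : X ⟶ Y) (g : X ⟶ Z) :
    mapHom φ hφ (lift f g) =
      lift (mapHom φ hφ f : (⟨X.len⟩ : Circ E') ⟶ ⟨Y.len⟩)
        (mapHom φ hφ g : (⟨X.len⟩ : Circ E') ⟶ ⟨Z.len⟩) :=
  Quotient.inductionOn₂ f g fun _ _ => rfl

theorem mapHom_castHom {m n : ℕ} (h : m = n) :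
    mapHom φ hφ (castHom E h) = castHom E' h :=
  congrArg (ofTerm E') (CircTerm.map_castId φ h)

theorem mapHom_fst (X Y : Circ E) :
    mapHom φ hφ (fst X Y) = fst (⟨X.len⟩ : Circ E') ⟨Y.len⟩ :=
  (mapHom_comp φ hφ (X ◁ discardHom Y) (ρ_ X).hom).trans
    (congrArg _ (mapHom_castHom φ hφ _))

theorem mapHom_snd (X Y : Circ E) :
    mapHom φ hφ (snd X Y) = snd (⟨X.len⟩ : Circ E') ⟨Y.len⟩ :=
  (mapHom_comp φ hφ (discardHom X ▷ Y) (λ_ Y).hom).trans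
    (congrArg _ (mapHom_castHom φ hφ _))

theorem mapHom_tensorμ (X Y Z W : Circ E) :
    mapHom φ hφ (tensorμ X Y Z W) =
      tensorμ (⟨X.len⟩ : Circ E') ⟨Y.len⟩ ⟨Z.len⟩ ⟨W.len⟩ := by
  rw [← ofTerm_interchange, ← ofTerm_interchange]
  refine congrArg (ofTerm E') ?_
  simp only [CircTerm.map, CircTerm.interchange, CircTerm.map_castId]

theorem mapHom_revComp {X Y Z : Circ E} (f : X ⟶ Y) (rf : X ⊗ Y ⟶ X) (rg : Y ⊗ Z ⟶ Y) :
    mapHom φ hφ (revComp f rf rg) =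
      revComp (mapHom φ hφ f : (⟨X.len⟩ : Circ E') ⟶ ⟨Y.len⟩)
        (mapHom φ hφ rf : (⟨X.len⟩ : Circ E') ⊗ ⟨Y.len⟩ ⟶ ⟨X.len⟩)
        (mapHom φ hφ rg : (⟨Y.len⟩ : Circ E') ⊗ ⟨Z.len⟩ ⟶ ⟨Y.len⟩) := by
  refine (mapHom_comp φ hφ (lift (fst X Z) ((f ▷ Z) ≫ rg)) rf).trans ?_
  rw [mapHom_lift, mapHom_fst]
  have h : mapHom φ hφ ((f ▷ Z) ≫ rg) =
      ((mapHom φ hφ f : (⟨X.len⟩ : Circ E') ⟶ ⟨Y.len⟩) ▷ (⟨Z.len⟩ : Circ E')) ≫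
        (mapHom φ hφ rg : (⟨Y.len⟩ : Circ E') ⊗ ⟨Z.len⟩ ⟶ ⟨Y.len⟩) :=
    (mapHom_comp φ hφ (f ▷ Z) rg).trans (congrArg (· ≫ _) (mapHom_tensorHom φ hφ f (𝟙 Z)))
  rw [h]
  rfl

theorem mapHom_revTensor {X Y X' Y' : Circ E} (rf : X ⊗ Y ⟶ X) (rg : X' ⊗ Y' ⟶ X') :
    mapHom φ hφ (revTensor rf rg) =
      revTensor (mapHom φ hφ rf : (⟨X.len⟩ : Circ E') ⊗ ⟨Y.len⟩ ⟶ ⟨X.len⟩)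
        (mapHom φ hφ rg : (⟨X'.len⟩ : Circ E') ⊗ ⟨Y'.len⟩ ⟶ ⟨X'.len⟩) := by
  refine (mapHom_comp φ hφ (tensorμ X X' Y Y') (rf ⊗ₘ rg)).trans ?_
  rw [mapHom_tensorμ, mapHom_tensorHom]
  rfl

theorem mapHom_snd_comp {X Y : Circ E} (f : Y ⟶ X) :
    mapHom φ hφ (snd X Y ≫ f) = snd (⟨X.len⟩ : Circ E') ⟨Y.len⟩ ≫ mapHom φ hφ f := by
  rw [mapHom_comp, mapHom_snd]

theorem mapHom_mulRev (X : Circ E) :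
    mapHom φ hφ (mulRev X) = mulRev (⟨X.len⟩ : Circ E') := by
  have h {p : X ⊗ X ⟶ X} {q : (⟨X.len⟩ : Circ E') ⊗ ⟨X.len⟩ ⟶ ⟨X.len⟩} (hp : mapHom φ hφ p = q) :
      mapHom φ hφ ((p ▷ X) ≫ CartesianDistributive.mul X) =
        (q ▷ (⟨X.len⟩ : Circ E')) ≫ CartesianDistributive.mul (⟨X.len⟩ : Circ E') := by
    subst hp
    exact (mapHom_comp φ hφ _ _).trans (congrArg (· ≫ _) (mapHom_tensorHom φ hφ p (𝟙 X)))
  refine (mapHom_lift φ hφ _ _).trans ?_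
  rw [h (mapHom_snd φ hφ X X), h (mapHom_fst φ hφ X X)]
  rfl

/-- Every clause of `rev` uses only cartesian distributive structure, which renaming preserves, so
agreement on generators propagates to all terms. -/
theorem mapHom_rev {ρ' : ∀ {m n : ℕ}, Γ' m n → Rev E' m n}
    (h : ∀ {m n : ℕ} (g : Γ m n), mapHom φ hφ (ρ g) = ρ' (φ g))
    {m n : ℕ} (t : CircTerm Γ m n) :
    mapHom φ hφ (rev E ρ t) = rev E' ρ' (CircTerm.map φ t) := by
  induction t with
  | gen g => exact h g
  | id n => exact mapHom_snd φ hφ ⟨n⟩ ⟨n⟩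
  | comp f g hf hg =>
    simp only [CircTerm.map, rev, ← hf, ← hg]
    exact mapHom_revComp φ hφ (ofTerm E f) (rev E ρ f) (rev E ρ g)
  | tensor f g hf hg =>
    simp only [CircTerm.map, rev, ← hf, ← hg]
    exact mapHom_revTensor φ hφ (rev E ρ f) (rev E ρ g)
  | twist m n => exact mapHom_snd_comp φ hφ (β_ (⟨n⟩ : Circ E) ⟨m⟩).hom
  | copy n => exact mapHom_snd_comp φ hφ (CartesianLeftAdditive.add (⟨n⟩ : Circ E))
  | discard n => rfl
  | add n => exact mapHom_snd_comp φ hφ (lift (𝟙 (⟨n⟩ : Circ E)) (𝟙 _))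
  | zero n => exact toUnit_unique _ _
  | mul n => exact mapHom_mulRev φ hφ ⟨n⟩
  | one n => exact toUnit_unique _ _

end Map

end Circ

/-! ### Polynomial circuits as reverse derivative categories -/

open ReverseDerivative

section PolyCirc

variable {S : Type u} [CommSemiring S]

/-- The only property of the semiring equations that reverse differentiation requires. -/
theorem ConstEq.domain_eq_zero {Γ : ℕ → ℕ → Type u} {c : S → CircTerm Γ 0 1} {m n : ℕ}
    {f g : CircTerm Γ m n} (h : ConstEq c f g) : m = 0 := by
  cases h <;> rfl

theorem PolyEqEq.domain_eq_zero {m n : ℕ} {f g : CircTerm (PolyEqGen S) m n}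
    (h : PolyEqEq S f g) : m = 0 := by
  cases h with
  | const h => exact h.domain_eq_zero
  | compare_self => rfl
  | compare_ne => rfl

/-- The reverse derivatives of constants. -/
def PolyCirc.genRev : ∀ {m n : ℕ}, PolyGen S m n →
    Circ.Rev (Γ := PolyGen S) (ConstEq polyConst) m n
  | _, _, .const _ => toUnit _

/-- The reverse derivatives of constants and of the comparator, that of the latter being the
reverse derivative of addition. -/
def PolyCircEq.genRev : ∀ {m n : ℕ}, PolyEqGen S m n →
    Circ.Rev (Γ := PolyEqGen S) (PolyEqEq S) m n
  | _, _, .base (.const _) => toUnit _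
  | _, _, .compare => snd _ _ ≫ lift (𝟙 (⟨1⟩ : PolyCircEq S)) (𝟙 (⟨1⟩ : PolyCircEq S))

theorem PolyCirc.isAdditive_genRev {m n : ℕ} : ∀ g : PolyGen S m n, IsAdditive (genRev g)
  | .const _ => isAdditive_of_unit _

theorem PolyCircEq.isAdditive_genRev {m n : ℕ} : ∀ g : PolyEqGen S m n, IsAdditive (genRev g)
  | .base (.const _) => isAdditive_of_unit _
  | .compare => isAdditive_snd_comp_copy

variable (S)

/-- The reverse differential combinator of polynomial circuits. -/
def PolyCirc.combinator : ReverseDifferentialCombinator (PolyCirc S) :=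
  (Circ.additiveReverseCombinator PolyCirc.isAdditive_genRev ConstEq.domain_eq_zero).toCombinator
    (Circ.isLinear_of_gen _ _ fun
      | .const _ => AdditiveReverseCombinator.isLinear_of_codomain_unit _)
    (Circ.isSymm_of_gen _ _ fun
      | .const _ => AdditiveReverseCombinator.isSymm_of_domain_unit _)

/-- The reverse differential combinator of polynomial circuits with a comparator. -/
def PolyCircEq.combinator : ReverseDifferentialCombinator (PolyCircEq S) :=
  (Circ.additiveReverseCombinator PolyCircEq.isAdditive_genRev
      PolyEqEq.domain_eq_zero).toCombinator
    (Circ.isLinear_of_gen _ _ fun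
      | .base (.const _) => AdditiveReverseCombinator.isLinear_of_codomain_unit _
      -- The comparator and addition have definitionally the same reverse derivative.
      | .compare => .of_R_eq (g := CartesianLeftAdditive.add (⟨1⟩ : PolyCircEq S)) rfl
          (AdditiveReverseCombinator.isLinear_add _))
    (Circ.isSymm_of_gen _ _ fun
      | .base (.const _) => AdditiveReverseCombinator.isSymm_of_domain_unit _
      | .compare => .of_R_eq (g := CartesianLeftAdditive.add (⟨1⟩ : PolyCircEq S)) rfl
          (AdditiveReverseCombinator.isSymm_add _))

variable {S} in
theorem PolyCircEq.circRel_map_base {m n : ℕ} (f g : CircTerm (PolyGen S) m n)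
    (h : ConstEq polyConst f g) :
    CircRel (PolyEqEq S) (CircTerm.map (fun _ _ g => PolyEqGen.base g) f)
      (CircTerm.map (fun _ _ g => PolyEqGen.base g) g) :=
  .ofEq (.const (by
    cases h <;> simp only [CircTerm.map, CircTerm.map_castId, polyConst] <;> constructor))

theorem PolyCircEq.combinator_incl {X Y : PolyCirc S} (f : X ⟶ Y) :
    (combinator S).R ((incl S).map f) = (incl S).map ((PolyCirc.combinator S).R f) :=
  Quotient.inductionOn f fun t => (Circ.mapHom_rev (ρ := PolyCirc.genRev)
    (ρ' := PolyCircEq.genRev) (E' := PolyEqEq S) (fun _ _ g => PolyEqGen.base g)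
    circRel_map_base (fun | .const _ => toUnit_unique _ _) t).symm

end PolyCirc

theorem mainTheorem3 (S : Type u) [CommSemiring S] :
    ∃ (R₀ : ReverseDifferentialCombinator (PolyCirc S))
      (R : ReverseDifferentialCombinator (PolyCircEq S)),
      -- `R₀` is the combinator of polynomial circuits
      (∀ s : S, R₀.R (PolyCirc.const s) = toUnit _) ∧
      (∀ A : PolyCirc S, R₀.R (CartesianDistributive.mul A) = mulRev A) ∧
      (∀ A : PolyCirc S, R₀.R (CartesianDistributive.one A) = toUnit _) ∧
      -- `R` is as for polynomial circuits, and `R[compare] = R[add]`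
      (∀ (X Y : PolyCirc S) (f : X ⟶ Y),
        R.R ((PolyCircEq.incl S).map f) = (PolyCircEq.incl S).map (R₀.R f)) ∧
      R.R (PolyCircEq.compare S) = R.R (CartesianLeftAdditive.add (⟨1⟩ : PolyCircEq S)) :=
  ⟨PolyCirc.combinator S, PolyCircEq.combinator S, fun _ => rfl, fun _ => rfl, fun _ => rfl,
    fun _ _ => PolyCircEq.combinator_incl S, rfl⟩
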